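/- **Theorem (localization error).** Let $d\ge 1$, $0<\alpha\le\beta$ and $\rho>0$. There are constants $c,C>0$, depending only on $d,\alpha,\beta,\rho$, such that the following holds for all $h,\tau>0$. Setting. Let $\mathcal T_h$ be a conforming mesh of finitely many closed parallelepipeds in $\mathbb R^d$ (distinct elements have disjoint interiors, and if they meet, then in a common face of some dimension) such that every element has diameter at most $\rho h$ and contains a ball of radius $h/\rho$. Let $\Omega=\operatorname{int}\bigcup_{K\in\mathcal T_h}K$, and let $A$ be measurable on $\Omega$ with $\alpha\le A\le\beta$ a.e. For $S\subseteq\Omega$ put $(v,w)_S=\int_S vw$, $a_S(v,w)=\int_S A\,\nabla v\cdot\nabla w$, $|||v|||_S=\big((v,v)_S+\tfrac{\tau^2}4a_S(v,v)\big)^{1/2}$ and $|||v|||=|||v|||_\Omega$. Let $V_h\subset H^1_0(\Omega)$ be the space of continuous functions that vanish outside $\Omega$ and are on each element a polynomial of degree at most one in each of its affine coordinates ($Q_1$ elements), and let $V_h(S)$ consist of the $v\in V_h$ that vanish outside $S$. Let $\mathtt N(S)=\operatorname{int}\bigcup\{K\in\mathcal T_h: K\cap\overline S\ne\emptyset\}$,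 $\mathtt N_1=\mathtt N$ and $\mathtt N_\ell(S)=\mathtt N(\mathtt N_{\ell-1}(S))$ for $\ell\ge2$. For a sequence $(z^n)_{n\ge0}$ put $\hat\partial_\tau^2z^n=\tau^{-2}(z^{n+1}-2z^n+z^{n-1})$, $\widehat{z^n}=\tfrac14(z^{n+1}+2z^n+z^{n-1})$ and $z^{n+1/2}=\tfrac12(z^{n+1}+z^n)$. Data and solutions. Let $\omega$ be a union of elements and let $f(t)\in L^2(\Omega)$, $t\ge 0$, vanish a.e. outside $\omega$. For each $k\ge0$ let $f_h^k\in V_h$ be the $L^2$-projection of $f(k\tau)$ onto $V_h$, or any element of $V_h$ with support in $\omega$. Let $(u_h^n)_{n\ge0}\subset V_h$ with $u_h^0,u_h^1\in V_h(\omega)$ satisfy $$(\hat\partial_\tau^2u_h^n,v)_\Omega+a_\Omega(\widehat{u_h^n},v)=(\widehat{f_h^n},v)_\Omega\qquad\text{for all }v\in V_h,\ n\ge1.$$ For $\ell\in\mathbb N$, $\ell\ge1$, let $(\tilde u_h^n)_{n\ge0}\subset V_h(\mathtt N_\ell(\omega))$ with $\tilde u_h^0=u_h^0$, $\tilde u_h^1=u_h^1$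 satisfy $$(\hat\partial_\tau^2\tilde u_h^n,v)_{\mathtt N_\ell(\omega)}+a_{\mathtt N_\ell(\omega)}(\widehat{\tilde u_h^n},v)=(\widehat{f_h^n},v)_{\mathtt N_\ell(\omega)}\qquad\text{for all }v\in V_h(\mathtt N_\ell(\omega)),\ n\ge1.$$ Conclusion. With $$C_{\tau,h}=c\,\frac\beta\alpha\Big(\frac\tau h+\frac h\tau\Big)\qquad\text{and}\qquad \gamma=\sqrt{\frac{C_{\tau,h}+\frac12}{1+C_{\tau,h}}}\in(0,1),$$ one has, for every $n\ge0$, $$|||u_h^{n+1/2}-\tilde u_h^{n+1/2}|||\le C\,C_{\tau,h}\,(9\ell)^{n/2}\,\gamma^\ell\,\max_{0\le k\le n}|||u_h^{k+1/2}|||.$$ -/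

import Mathlib

open MeasureTheory

noncomputable section

namespace WaveLoc

/-- `ℝ^d` with the Euclidean norm. -/
abbrev E (d : ℕ) : Type := EuclideanSpace ℝ (Fin d)

/-- The affine map `t ↦ b + ∑ k, t k • e k`; it maps the unit cube onto the parallelepiped with
corner `b` and edge vectors `e`. -/
def affChart {d : ℕ} (b : E d) (e : Fin d → E d) (t : Fin d → ℝ) : E d :=
  b + ∑ k, t k • e k

/-- The face of the unit cube `[0,1]^d` on which the coordinates in `I₀` are `0` and those in `I₁`
are `1`. -/
def cubeFace {d : ℕ} (I₀ I₁ : Set (Fin d)) : Set (Fin d → ℝ) :=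
  {t | t ∈ Set.Icc 0 1 ∧ (∀ k ∈ I₀, t k = 0) ∧ (∀ k ∈ I₁, t k = 1)}

/-- A conforming mesh of finitely many nondegenerate closed parallelepipeds in `ℝ^d`: distinct
elements have disjoint interiors, and if they meet, they meet in a common face (of any
dimension). -/
structure Mesh (d : ℕ) where
  /-- the number of elements -/
  card : ℕ
  /-- a corner of each element -/
  base : Fin card → E d
  /-- the edge vectors of each element -/
  edge : Fin card → Fin d → E d
  nondegenerate : ∀ i, LinearIndependent ℝ (edge i)
  disjoint_interior : ∀ i j, i ≠ j →
    Disjoint (interior (affChart (base i) (edge i) '' Set.Icc 0 1))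
      (interior (affChart (base j) (edge j) '' Set.Icc 0 1))
  face_to_face : ∀ i j, i ≠ j →
    (affChart (base i) (edge i) '' Set.Icc 0 1 ∩
      affChart (base j) (edge j) '' Set.Icc 0 1).Nonempty →
    ∃ I₀ I₁ J₀ J₁ : Set (Fin d),
      affChart (base i) (edge i) '' Set.Icc 0 1 ∩ affChart (base j) (edge j) '' Set.Icc 0 1
          = affChart (base i) (edge i) '' cubeFace I₀ I₁ ∧
      affChart (base i) (edge i) '' Set.Icc 0 1 ∩ affChart (base j) (edge j) '' Set.Icc 0 1
          = affChart (base j) (edge j) '' cubeFace J₀ J₁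

namespace Mesh

variable {d : ℕ}

/-- The closed element with index `i`. -/
def elem (T : Mesh d) (i : Fin T.card) : Set (E d) :=
  affChart (T.base i) (T.edge i) '' Set.Icc 0 1

/-- The (closed) union of the elements whose index lies in `s`. -/
def unionOf (T : Mesh d) (s : Set (Fin T.card)) : Set (E d) := ⋃ i ∈ s, T.elem i

/-- The open domain `Ω` that is meshed by `T`. -/
def domain (T : Mesh d) : Set (E d) := interior (T.unionOf Set.univ)

/-- Shape regularity and quasi-uniformity, with parameter `ρ`, for the mesh size `h`: every element
has diameter at most `ρ h` and contains a ball of radius `h / ρ`. -/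
def IsQuasiUniform (T : Mesh d) (ρ h : ℝ) : Prop :=
  ∀ i, Metric.diam (T.elem i) ≤ ρ * h ∧ ∃ x, Metric.ball x (h / ρ) ⊆ T.elem i

/-- The space `V_h ⊆ H¹₀(Ω)` of `Q₁` finite elements. Its members are extended by zero to `ℝ^d`:
they are continuous, vanish outside `Ω` (hence on `∂Ω`), and on every element are a polynomial of
degree at most one in each of the affine coordinates of that element. -/
def Vh (T : Mesh d) : Set (E d → ℝ) :=
  {v | Continuous v ∧ (∀ x, x ∉ T.domain → v x = 0) ∧
    ∀ i, ∃ p : MvPolynomial (Fin d) ℝ, (∀ k, p.degreeOf k ≤ 1) ∧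
      ∀ t ∈ Set.Icc (0 : Fin d → ℝ) 1,
        v (affChart (T.base i) (T.edge i) t) = MvPolynomial.eval t p}

/-- `V_h(S)`: the finite element functions that vanish outside `S`. Being continuous, they vanish
on the boundary of `S` as well. -/
def VhOn (T : Mesh d) (S : Set (E d)) : Set (E d → ℝ) :=
  {v | v ∈ T.Vh ∧ Function.support v ⊆ S}

/-- The element patch `N(S)`: the interior of the union of all elements that meet `closure S`. -/
def nbhd (T : Mesh d) (S : Set (E d)) : Set (E d) :=
  interior (T.unionOf {i | (closure S ∩ T.elem i).Nonempty})

/-- The patches `N_0(S) = int S`, `N_1(S) = N(S)`, `N_ℓ(S) = N(N_{ℓ-1}(S))` for `ℓ ≥ 2`. -/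
def patch (T : Mesh d) (S : Set (E d)) : ℕ → Set (E d)
  | 0 => interior S
  | 1 => T.nbhd S
  | l + 2 => T.nbhd (T.patch S (l + 1))

end Mesh

variable {d : ℕ}

/-- The inner product `(v, w)_S` of `L²(S)`. -/
def l2 (S : Set (E d)) (v w : E d → ℝ) : ℝ := ∫ x in S, v x * w x

/-- The form `a_S(v, w) = (A ∇v, ∇w)_{L²(S)}`. A finite element function is differentiable off the
element boundaries, a null set, so the pointwise gradient is its weak gradient. -/
def aForm (A : E d → ℝ) (S : Set (E d)) (v w : E d → ℝ) : ℝ :=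
  ∫ x in S, A x * inner ℝ (gradient v x) (gradient w x)

/-- The norm `|||v|||_S = ( ‖v‖²_{L²(S)} + (τ²/4) a_S(v, v) )^{1/2}`. -/
def cnNorm (A : E d → ℝ) (τ : ℝ) (S : Set (E d)) (v : E d → ℝ) : ℝ :=
  Real.sqrt (l2 S v v + τ ^ 2 / 4 * aForm A S v v)

/-- The second difference quotient `τ⁻² (z^{n+1} - 2 z^n + z^{n-1})` (used for `n ≥ 1`). -/
def secondDiff (τ : ℝ) (z : ℕ → E d → ℝ) (n : ℕ) : E d → ℝ :=
  fun x => (z (n + 1) x - 2 * z n x + z (n - 1) x) / τ ^ 2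

/-- The average `(z^{n+1} + 2 z^n + z^{n-1}) / 4` (used for `n ≥ 1`). -/
def hatAvg (z : ℕ → E d → ℝ) (n : ℕ) : E d → ℝ :=
  fun x => (z (n + 1) x + 2 * z n x + z (n - 1) x) / 4

/-- The half-step value `z^{n+1/2} = (z^{n+1} + z^n) / 2`. -/
def halfStep (z : ℕ → E d → ℝ) (n : ℕ) : E d → ℝ :=
  fun x => (z (n + 1) x + z n x) / 2

/-- `z` solves the Crank–Nicolson scheme on `S` with trial and test space `V`, step size `τ`,
coefficient `A` and discrete right-hand sides `fh`. -/
def IsCrankNicolson (A : E d → ℝ) (τ : ℝ) (S : Set (E d)) (V : Set (E d → ℝ))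
    (fh z : ℕ → E d → ℝ) : Prop :=
  (∀ n, z n ∈ V) ∧
    ∀ n, 1 ≤ n → ∀ v ∈ V,
      l2 S (secondDiff τ z n) v + aForm A S (hatAvg z n) v = l2 S (hatAvg fh n) v

/-- The decay rate `γ = ((C + 1/2) / (1 + C))^{1/2}`. -/
def decayRate (C : ℝ) : ℝ := Real.sqrt ((C + 1 / 2) / (1 + C))

end WaveLoc

end

/-! Put b = (·,·) + (τ²/4) a. Since z^{n+1} - 2z^n + z^{n-1} = (z^{n+1} + 2z^n + z^{n-1}) - 4z^n,
one step of the scheme, multiplied by τ²/4, is the elliptic problem b(ẑ^n, v) = (z^n, v) for every v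
that vanishes on ω, ẑ^n being the weighted mean. A reaction–diffusion operator of this kind has
solutions that decay exponentially over layers of elements. Testing with a discrete cut-off of ẑ^n,
zero on k layers and unchanged beyond layer k + 1, gives (1 + K) B_{k+1} ≤ K B_k + (forcing), where
B_k is the b-energy outside k layers (`CutSystem.decay_step`). K is governed by the stability of the
cut-off, hence by an inverse estimate, hence by τ/h.

The forcing z^n is not local, but it is an alternating sum of earlier half steps, which decay by
induction in time. Forcing with the same decay rate as the solution costs a factor ℓ in the squared
norm, thus √ℓ per time step. This is the origin of the growth (2√ℓ)^n in `CutSystem.solution_decay`;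
the b-norms of the global half steps enter only through their maximum M.

For the error u - ũ, split u = Zu + (u - Zu) with Z the last cut-off whose remainder u - Zu still
lies in the local space. The part r = Zu is small by the decay. The rest θ = u - Zu - ũ is an
admissible local test function, and r + θ satisfies the homogeneous scheme on the local space. The
discrete energy identity (`energy_step`, `energy_bound`) controls r + θ by r, with a cubic loss in n
that is absorbed by replacing 2√ℓ by 3√ℓ (`CutSystem.localization_error`).

It remains to realize the cut-off in V_h: set the nodal values on the inner layers to zero and
interpolate. Continuity across elements rests on conformity: on a common face the edge directions of
two elements agree up to order and sign (`Mesh.transition_signed_permutation`, `Mesh.qint_compat`).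
The zero boundary values rest on `Mesh.mem_domain_of_face`. Stability follows elementwise, because
vertex values are comparable to the L² norm (`exists_sum_sq_le_integral`) and control gradients
(`Mesh.norm_gradient_le`). -/

noncomputable section

namespace WaveLoc

open LinearMap (BilinForm)

/-! ### Semidefinite forms and energy stability of the Crank–Nicolson scheme. -/

section Seminorm

variable {V : Type*} [AddCommGroup V] [Module ℝ V]

/-- The seminorm attached to a positive semidefinite form. -/
def semi (B : BilinForm ℝ V) (v : V) : ℝ := Real.sqrt (B v v)

lemma semi_nonneg (B : BilinForm ℝ V) (v : V) : 0 ≤ semi B v := Real.sqrt_nonneg _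

lemma semi_sq {B : BilinForm ℝ V} (hB : B.IsPosSemidef) (v : V) : semi B v ^ 2 = B v v :=
  Real.sq_sqrt (hB.nonneg v)

lemma abs_apply_le {B : BilinForm ℝ V} (hB : B.IsPosSemidef) (v w : V) :
    |B v w| ≤ semi B v * semi B w := by
  have h := LinearMap.BilinForm.apply_sq_le_of_symm B hB.nonneg ⟨fun x y => by simpa using hB.eq x y⟩ v w
  apply abs_le_of_sq_le_sq _ (mul_nonneg (semi_nonneg _ _) (semi_nonneg _ _))
  rw [mul_pow, semi_sq hB, semi_sq hB]
  exact h

lemma semi_add_le {B : BilinForm ℝ V} (hB : B.IsPosSemidef) (v w : V) :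
    semi B (v + w) ≤ semi B v + semi B w := by
  apply Real.sqrt_le_iff.2 ⟨add_nonneg (semi_nonneg _ _) (semi_nonneg _ _), ?_⟩
  have h := (abs_le.1 (abs_apply_le hB v w)).2
  have h2 : B w v = B v w := hB.eq w v
  simp only [map_add, LinearMap.add_apply]
  nlinarith [semi_sq hB v, semi_sq hB w]

lemma semi_smul (B : BilinForm ℝ V) (c : ℝ) (v : V) :
    semi B (c • v) = |c| * semi B v := by
  unfold semi
  simp only [map_smul, LinearMap.smul_apply, smul_eq_mul]
  rw [← mul_assoc, Real.sqrt_mul (mul_self_nonneg c), Real.sqrt_mul_self_eq_abs]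

lemma semi_neg (B : BilinForm ℝ V) (v : V) : semi B (-v) = semi B v := by
  simpa using semi_smul B (-1) v

lemma semi_sub_le {B : BilinForm ℝ V} (hB : B.IsPosSemidef) (v w : V) :
    semi B (v - w) ≤ semi B v + semi B w := by
  rw [sub_eq_add_neg, ← semi_neg B w]
  exact semi_add_le hB _ _

lemma semi_le_semi {B B' : BilinForm ℝ V} {v w : V} (h : B v v ≤ B' w w) :
    semi B v ≤ semi B' w := Real.sqrt_le_sqrt h

lemma isPosSemidef_sum {ι : Type*} (J : Finset ι) {f : ι → BilinForm ℝ V}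
    (h : ∀ i, (f i).IsPosSemidef) : (∑ i ∈ J, f i).IsPosSemidef := by
  classical
  induction J using Finset.induction_on with
  | empty => simp [LinearMap.BilinForm.isPosSemidef_zero]
  | insert i J hi ih => rw [Finset.sum_insert hi]; exact (h i).add ih

/-- The half-step mean of a sequence. -/
def half (z : ℕ → V) (n : ℕ) : V := (1 / 2 : ℝ) • (z (n + 1) + z n)

/-- The second difference of a sequence, centred at `n + 1`. -/
def del (z : ℕ → V) (n : ℕ) : V := z (n + 2) - (2 : ℝ) • z (n + 1) + z n

/-- Four times the weighted mean of a sequence, centred at `n + 1`. -/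
def sig (z : ℕ → V) (n : ℕ) : V := z (n + 2) + (2 : ℝ) • z (n + 1) + z n

lemma sig_eq (z : ℕ → V) (n : ℕ) : sig z n = (2 : ℝ) • (half z (n + 1) + half z n) := by
  unfold sig half; module

lemma del_eq (z : ℕ → V) (n : ℕ) : del z n = sig z n - (4 : ℝ) • z (n + 1) := by
  unfold sig del; module

/-- Full steps are alternating sums of half steps. -/
lemma semi_le_sum_half {B : BilinForm ℝ V} (hB : B.IsPosSemidef) (z : ℕ → V)
    (h0 : semi B (z 0) = 0) (j : ℕ) :
    semi B (z j) ≤ 2 * ∑ i ∈ Finset.range j, semi B (half z i) := by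
  induction j with
  | zero => simp [h0]
  | succ j ih =>
    have h : z (j + 1) = (2 : ℝ) • half z j - z j := by unfold half; module
    rw [Finset.sum_range_succ, h]
    have := semi_sub_le hB ((2 : ℝ) • half z j) (z j)
    rw [semi_smul, abs_of_pos two_pos] at this
    linarith

/-- Stability of the Crank–Nicolson scheme under a nonconforming perturbation `r`: one step of the
discrete energy balance. -/
lemma energy_step {m a : BilinForm ℝ V} (hm : m.IsPosSemidef) (ha : a.IsPosSemidef)
    (W : Submodule ℝ V) (r θ : ℕ → V) (hθ : ∀ n, θ n ∈ W)
    (heq : ∀ n, ∀ v ∈ W, m (del r n + del θ n) v + a (sig r n + sig θ n) v = 0) (n : ℕ) :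
    Real.sqrt (m (θ (n + 2) - θ (n + 1)) (θ (n + 2) - θ (n + 1))
        + 4 * a (half θ (n + 1)) (half θ (n + 1))) ≤
      Real.sqrt (m (θ (n + 1) - θ n) (θ (n + 1) - θ n) + 4 * a (half θ n) (half θ n))
        + semi m (del r n) + semi a (sig r n) := by
  set x := θ (n + 2) - θ (n + 1) with hx
  set y := θ (n + 1) - θ n with hy
  set p := half θ (n + 1) with hp
  set q := half θ n with hq
  set P' := Real.sqrt (m x x + 4 * a p p) with hP'
  set P := Real.sqrt (m y y + 4 * a q q) with hP
  have hP's : P' ^ 2 = m x x + 4 * a p p :=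
    Real.sq_sqrt (add_nonneg (hm.nonneg x) (mul_nonneg (by norm_num) (ha.nonneg p)))
  have hPs : P ^ 2 = m y y + 4 * a q q :=
    Real.sq_sqrt (add_nonneg (hm.nonneg y) (mul_nonneg (by norm_num) (ha.nonneg q)))
  have hP'0 : 0 ≤ P' := Real.sqrt_nonneg _
  have hP0 : 0 ≤ P := Real.sqrt_nonneg _
  have h1 : semi m x ≤ P' := Real.sqrt_le_sqrt (by linarith [ha.nonneg p])
  have h2 : semi m y ≤ P := Real.sqrt_le_sqrt (by linarith [ha.nonneg q])
  have h3 : 2 * semi a p ≤ P' := by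
    apply Real.le_sqrt_of_sq_le
    rw [mul_pow, semi_sq ha]; linarith [hm.nonneg x]
  have h4 : 2 * semi a q ≤ P := by
    apply Real.le_sqrt_of_sq_le
    rw [mul_pow, semi_sq ha]; linarith [hm.nonneg y]
  -- The test function θ^{n+2} - θ^n is both the sum x + y of two increments and twice the
  -- difference p - q of two half steps, so the mass and the energy terms each become a difference
  -- of squares. No inverse estimate is needed.
  have hvW : x + y ∈ W := W.add_mem (W.sub_mem (hθ _) (hθ _)) (W.sub_mem (hθ _) (hθ _))
  have hv2 : x + y = (2 : ℝ) • (p - q) := by rw [hx, hy, hp, hq]; unfold half; module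
  have hd : del θ n = x - y := by rw [hx, hy]; unfold del; module
  have hs : sig θ n = (2 : ℝ) • (p + q) := sig_eq θ n
  have e := heq n _ hvW
  have e1 : m (del r n + del θ n) (x + y) = m (del r n) (x + y) + (m x x - m y y) := by
    rw [hd]
    have := hm.eq x y
    simp only [map_add, map_sub, LinearMap.add_apply, LinearMap.sub_apply]
    linarith
  have e2 : a (sig r n + sig θ n) (x + y) = a (sig r n) (x + y) + 4 * (a p p - a q q) := by
    rw [hs, map_add a, LinearMap.add_apply]
    congr 1
    rw [hv2]
    have := ha.eq p q
    simp only [map_add, map_sub, map_smul, LinearMap.add_apply, LinearMap.smul_apply, smul_eq_mul]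
    linarith
  have b1 := (abs_le.1 (abs_apply_le hm (del r n) (x + y))).1
  have b2 := (abs_le.1 (abs_apply_le ha (sig r n) (x + y))).1
  have c1 : semi m (x + y) ≤ P' + P := (semi_add_le hm x y).trans (by linarith)
  have c2 : semi a (x + y) ≤ P' + P := by
    rw [hv2, semi_smul, abs_of_pos two_pos]
    have := semi_sub_le ha p q
    linarith
  have d1 := mul_le_mul_of_nonneg_left c1 (semi_nonneg m (del r n))
  have d2 := mul_le_mul_of_nonneg_left c2 (semi_nonneg a (sig r n))
  -- Both seminorms of the test function are at most P' + P, so this factor can be divided out.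
  have key : (P' - P) * (P' + P) ≤ (semi m (del r n) + semi a (sig r n)) * (P' + P) := by
    nlinarith
  rcases (add_nonneg hP'0 hP0).eq_or_lt with h0 | h0
  · have := semi_nonneg m (del r n)
    have := semi_nonneg a (sig r n)
    linarith
  · have := le_of_mul_le_mul_right key h0
    linarith

lemma semi_add_form_le {m a : BilinForm ℝ V} (hm : m.IsPosSemidef) (ha : a.IsPosSemidef) (v : V) :
    semi (m + a) v ≤ semi m v + semi a v := by
  apply Real.sqrt_le_iff.2 ⟨add_nonneg (semi_nonneg _ _) (semi_nonneg _ _), ?_⟩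
  simp only [LinearMap.add_apply]
  nlinarith [semi_sq hm v, semi_sq ha v, mul_nonneg (semi_nonneg m v) (semi_nonneg a v)]

/-- Accumulated stability estimate: the error `r + θ` of a scheme started from rest grows at most
cubically in the number of steps. -/
lemma energy_bound {m a : BilinForm ℝ V} (hm : m.IsPosSemidef) (ha : a.IsPosSemidef)
    (W : Submodule ℝ V) (r θ : ℕ → V) (hθ : ∀ n, θ n ∈ W)
    (heq : ∀ n, ∀ v ∈ W, m (del r n + del θ n) v + a (sig r n + sig θ n) v = 0)
    (h0 : r 0 + θ 0 = 0) (h1 : r 1 + θ 1 = 0)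
    (hr0 : semi (m + a) (r 0) = 0) (hr1 : semi (m + a) (r 1) = 0)
    (N : ℕ) (ϱ : ℝ) (hϱ : 0 ≤ ϱ) (hR : ∀ j ≤ N, semi (m + a) (half r j) ≤ ϱ) :
    semi (m + a) (half (fun n => r n + θ n) N) ≤ 16 * (N + 1) ^ 3 * ϱ := by
  have hb : (m + a).IsPosSemidef := hm.add ha
  have hmb : ∀ v, semi m v ≤ semi (m + a) v := fun v =>
    semi_le_semi (by simpa using ha.nonneg v)
  have hab : ∀ v, semi a v ≤ semi (m + a) v := fun v =>
    semi_le_semi (by simpa using hm.nonneg v)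
  have hz : ∀ v, semi (m + a) v = 0 → semi m v = 0 ∧ semi a v = 0 := fun v hv =>
    ⟨le_antisymm ((hmb v).trans hv.le) (semi_nonneg _ _),
      le_antisymm ((hab v).trans hv.le) (semi_nonneg _ _)⟩
  have hθ0 : θ 0 = - r 0 := (neg_eq_of_add_eq_zero_right h0).symm
  have hθ1 : θ 1 = - r 1 := (neg_eq_of_add_eq_zero_right h1).symm
  -- First of three powers of N: only half steps of r are controlled, while `del r n` contains the
  -- full step `r (n + 1)`, an alternating sum of n + 1 half steps.
  have hrm : ∀ j ≤ N, semi m (r j) ≤ 2 * j * ϱ := by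
    intro j hj
    refine (semi_le_sum_half hm r (hz _ hr0).1 j).trans ?_
    have : ∑ i ∈ Finset.range j, semi m (half r i) ≤ ∑ i ∈ Finset.range j, ϱ :=
      Finset.sum_le_sum fun i hi =>
        (hmb _).trans (hR i (by have := Finset.mem_range.1 hi; omega))
    rw [Finset.sum_const, Finset.card_range, nsmul_eq_mul] at this
    linarith
  have hsig : ∀ n, n + 1 ≤ N → semi (m + a) (sig r n) ≤ 4 * ϱ := by
    intro n hn
    rw [sig_eq, semi_smul, abs_of_pos two_pos]
    have := semi_add_le hb (half r (n + 1)) (half r n)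
    linarith [hR (n + 1) hn, hR n (by omega)]
  have hdel : ∀ n, n + 1 ≤ N → semi m (del r n) ≤ 4 * ϱ + 8 * (n + 1) * ϱ := by
    intro n hn
    rw [del_eq]
    have h := semi_sub_le hm (sig r n) ((4 : ℝ) • r (n + 1))
    rw [semi_smul, abs_of_pos (by norm_num)] at h
    have h' := hrm (n + 1) hn
    push_cast at h'
    linarith [(hmb (sig r n)).trans (hsig n hn)]
  set P : ℕ → ℝ := fun n => Real.sqrt
    (m (θ (n + 1) - θ n) (θ (n + 1) - θ n) + 4 * a (half θ n) (half θ n)) with hP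
  have hhalf0 : ∀ B : BilinForm ℝ V, B.IsPosSemidef → semi B (r 0) = 0 → semi B (r 1) = 0 →
      semi B (half θ 0) = 0 := by
    intro B hB hB0 hB1
    apply le_antisymm _ (semi_nonneg _ _)
    unfold half
    rw [semi_smul]
    have := semi_add_le hB (θ (0 + 1)) (θ 0)
    rw [zero_add, hθ0, hθ1, semi_neg, semi_neg, hB0, hB1] at this
    rw [zero_add, hθ0, hθ1]
    have h5 : |(1 / 2 : ℝ)| = 1 / 2 := abs_of_pos (by norm_num)
    rw [h5]; linarith
  have hP0 : P 0 = 0 := by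
    have e1 : semi m (θ (0 + 1) - θ 0) = 0 := by
      apply le_antisymm _ (semi_nonneg _ _)
      have := semi_sub_le hm (θ (0 + 1)) (θ 0)
      rw [zero_add, hθ0, hθ1, semi_neg, semi_neg, (hz _ hr0).1, (hz _ hr1).1] at this
      rw [zero_add, hθ0, hθ1]; linarith
    have e2 := hhalf0 a ha (hz _ hr0).2 (hz _ hr1).2
    have e3 := semi_sq hm (θ (0 + 1) - θ 0)
    have e4 := semi_sq ha (half θ 0)
    simp only [hP]
    rw [← e3, ← e4, e1, e2]; simp
  -- Second power: summing the increments, which are at most (16 + 8n)ϱ ≤ 16((n + 1)² - n²)ϱ.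
  have hPn : ∀ n ≤ N, P n ≤ 16 * n ^ 2 * ϱ := by
    intro n
    induction n with
    | zero => intro _; simp [hP0]
    | succ n ih =>
      intro hn
      have s := energy_step hm ha W r θ hθ heq n
      have i := ih (by omega)
      have i2 := hdel n hn
      have i3 := (hab (sig r n)).trans (hsig n hn)
      have : P (n + 1) ≤ P n + semi m (del r n) + semi a (sig r n) := s
      push_cast
      nlinarith [mul_nonneg (Nat.cast_nonneg (α := ℝ) n) hϱ]
  have hDm : ∀ n, semi m (θ (n + 1) - θ n) ≤ P n := fun n =>
    Real.sqrt_le_sqrt (by linarith [ha.nonneg (half θ n)])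
  have hTa : ∀ n, 2 * semi a (half θ n) ≤ P n := fun n => by
    apply Real.le_sqrt_of_sq_le
    rw [mul_pow, semi_sq ha]; linarith [hm.nonneg (θ (n + 1) - θ n)]
  -- Third power: the energy sees θ in the mass seminorm only through its increments, so θ itself is
  -- recovered by one more summation.
  have hTm : ∀ n ≤ N, semi m (half θ n) ≤ 16 * n ^ 3 * ϱ := by
    intro n
    induction n with
    | zero => intro _; simp [hhalf0 m hm (hz _ hr0).1 (hz _ hr1).1]
    | succ n ih =>
      intro hn
      have e : half θ (n + 1) = half θ n +
          (1 / 2 : ℝ) • ((θ (n + 1 + 1) - θ (n + 1)) + (θ (n + 1) - θ n)) := by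
        unfold half; module
      rw [e]
      have s1 := semi_add_le hm (half θ n)
        ((1 / 2 : ℝ) • ((θ (n + 1 + 1) - θ (n + 1)) + (θ (n + 1) - θ n)))
      rw [semi_smul, abs_of_pos (by norm_num)] at s1
      have s2 := semi_add_le hm (θ (n + 1 + 1) - θ (n + 1)) (θ (n + 1) - θ n)
      have s3 := (hDm (n + 1)).trans (hPn _ hn)
      have s4 := (hDm n).trans (hPn n (by omega))
      have s5 := ih (by omega)
      push_cast at *
      have hn0 : (0 : ℝ) ≤ n := Nat.cast_nonneg n
      nlinarith [mul_nonneg hn0 hϱ, mul_nonneg (mul_nonneg hn0 hn0) hϱ]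
  have hE : half (fun n => r n + θ n) N = half r N + half θ N := by unfold half; module
  rw [hE]
  have t1 := semi_add_le hb (half r N) (half θ N)
  have t2 := semi_add_form_le hm ha (half θ N)
  have t3 := hTm N le_rfl
  have t4 := (hTa N).trans (hPn N le_rfl)
  have t5 := hR N le_rfl
  have hn0 : (0 : ℝ) ≤ N := Nat.cast_nonneg N
  nlinarith [mul_nonneg hn0 hϱ, mul_nonneg (mul_nonneg hn0 hn0) hϱ]

end Seminorm

/-! ### Abstract cut-off systems: decay in layers and the localization error. -/

section Localization

/-- Elementwise positive semidefinite forms (an `L²` part `m` and an energy part `a`), an increasing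
sequence of sets of elements `S k`, and cut-off operators `Z k` that annihilate on `S k`, do nothing
off `S (k + 1)`, and are stable with constants `κ₀` in the `L²` part and `κ` in total. -/
structure CutSystem (V ι : Type*) [AddCommGroup V] [Module ℝ V] [Fintype ι] where
  m : ι → BilinForm ℝ V
  a : ι → BilinForm ℝ V
  hm : ∀ i, (m i).IsPosSemidef
  ha : ∀ i, (a i).IsPosSemidef
  S : ℕ → Finset ι
  mono : Monotone S
  Z : ℕ → V →ₗ[ℝ] V
  κ₀ : ℝ
  κ : ℝ
  one_le : 1 ≤ κ
  cut_inside : ∀ k, ∀ i ∈ S k, ∀ v w, m i w (Z k v) = 0 ∧ a i w (Z k v) = 0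
  cut_outside : ∀ k, ∀ i ∉ S (k + 1), ∀ v w, m i w (Z k v) = m i w v ∧ a i w (Z k v) = a i w v
  cut_m : ∀ k i v, m i (Z k v) (Z k v) ≤ κ₀ ^ 2 * m i v v
  cut_b : ∀ k i v, m i (Z k v) (Z k v) + a i (Z k v) (Z k v) ≤ κ ^ 2 * m i v v

namespace CutSystem

variable {V ι : Type*} [AddCommGroup V] [Module ℝ V] [Fintype ι]

/-- The total form on a set of elements. -/
def bOn (D : CutSystem V ι) (J : Finset ι) : BilinForm ℝ V := ∑ i ∈ J, (D.m i + D.a i)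

/-- The `L²` form on a set of elements. -/
def mOn (D : CutSystem V ι) (J : Finset ι) : BilinForm ℝ V := ∑ i ∈ J, D.m i

/-- The energy form on a set of elements. -/
def aOn (D : CutSystem V ι) (J : Finset ι) : BilinForm ℝ V := ∑ i ∈ J, D.a i

variable (D : CutSystem V ι)

lemma bOn_psd (J : Finset ι) : (D.bOn J).IsPosSemidef :=
  isPosSemidef_sum J fun i => (D.hm i).add (D.ha i)

lemma mOn_psd (J : Finset ι) : (D.mOn J).IsPosSemidef := isPosSemidef_sum J D.hm

lemma aOn_psd (J : Finset ι) : (D.aOn J).IsPosSemidef := isPosSemidef_sum J D.ha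

lemma bOn_eq (J : Finset ι) : D.bOn J = D.mOn J + D.aOn J := Finset.sum_add_distrib

lemma bOn_apply (J : Finset ι) (v w : V) : D.bOn J v w = ∑ i ∈ J, (D.m i v w + D.a i v w) := by
  simp [bOn, LinearMap.sum_apply]

lemma mOn_apply (J : Finset ι) (v w : V) : D.mOn J v w = ∑ i ∈ J, D.m i v w := by
  simp [mOn, LinearMap.sum_apply]

lemma bOn_mono {J J' : Finset ι} (h : J ⊆ J') (v : V) : D.bOn J v v ≤ D.bOn J' v v := by
  rw [bOn_apply, bOn_apply]
  exact Finset.sum_le_sum_of_subset_of_nonneg h fun i _ _ =>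
    add_nonneg ((D.hm i).nonneg v) ((D.ha i).nonneg v)

lemma mOn_le_bOn (J : Finset ι) (v : V) : semi (D.mOn J) v ≤ semi (D.bOn J) v := by
  apply semi_le_semi
  rw [bOn_eq, LinearMap.add_apply, LinearMap.add_apply]
  linarith [(D.aOn_psd J).nonneg v]

variable [DecidableEq ι]

/-- Caccioppoli-type step: away from the data the energy decays from layer to layer. -/
lemma decay_step (w g : V) (k : ℕ) (K : ℝ) (hK : 2 * D.κ + D.κ₀ ^ 2 ≤ K)
    (h : D.bOn Finset.univ w (D.Z k w) = D.mOn Finset.univ g (D.Z k w)) :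
    (1 + K) * D.bOn (D.S (k + 1))ᶜ w w ≤ K * D.bOn (D.S k)ᶜ w w + D.mOn (D.S k)ᶜ g g := by
  set K₁ := 2 * D.κ + D.κ₀ ^ 2 with hK₁
  set v := D.Z k w with hv
  have hb : ∀ i, (D.m i + D.a i).IsPosSemidef := fun i => (D.hm i).add (D.ha i)
  -- Half of the claim, element by element. On `S k` both sides vanish. Off `S (k + 1)` the test
  -- function is w, and Young's inequality for the forcing leaves half of the energy. In the
  -- transition layer Cauchy–Schwarz loses κ times the energy from b(w, v) and κ₀²/2 times the mass
  -- from the forcing, together K₁/2.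
  have hpt : ∀ i ∈ (Finset.univ : Finset ι),
      (if i ∈ (D.S (k + 1))ᶜ then (1 / 2 + K₁ / 2) * (D.m i w w + D.a i w w) else 0) -
      (if i ∈ (D.S k)ᶜ then K₁ / 2 * (D.m i w w + D.a i w w) + 1 / 2 * D.m i g g else 0) ≤
      (D.m i w v + D.a i w v) - D.m i g v := by
    intro i _
    simp only [Finset.mem_compl]
    by_cases h1 : i ∈ D.S k
    · have h2 : i ∈ D.S (k + 1) := D.mono (Nat.le_succ k) h1
      have e1 := D.cut_inside k i h1 w w
      have e2 := D.cut_inside k i h1 w g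
      simp [h1, h2, hv ▸ e1.1, hv ▸ e1.2, hv ▸ e2.1]
    · have g1 := semi_sq (D.hm i) g
      have gw := (abs_le.1 (abs_apply_le (D.hm i) g w)).2
      have w1 := semi_sq (D.hm i) w
      have wa := (D.ha i).nonneg w
      have wm := (D.hm i).nonneg w
      by_cases h2 : i ∈ D.S (k + 1)
      · simp only [h1, h2, not_true_eq_false, not_false_eq_true, if_true, if_false]
        have c1 := D.cut_m k i w
        have c2 := D.cut_b k i w
        rw [← hv] at c1 c2
        have b1 := (abs_le.1 (abs_apply_le (hb i) w v)).1
        have b2 := semi_sq (hb i) w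
        have b3 := semi_sq (hb i) v
        have gv := (abs_le.1 (abs_apply_le (D.hm i) g v)).2
        have v1 := semi_sq (D.hm i) v
        simp only [LinearMap.add_apply] at b1 b2 b3
        have hκ : 0 ≤ D.κ := zero_le_one.trans D.one_le
        have b4 : semi (D.m i + D.a i) v ≤ D.κ * semi (D.m i + D.a i) w := by
          apply abs_le_of_sq_le_sq' _ (mul_nonneg hκ (semi_nonneg _ _)) |>.2
          rw [mul_pow, b2, b3]
          nlinarith [mul_nonneg (sq_nonneg D.κ) wa]
        have b5 := mul_le_mul_of_nonneg_left b4 (semi_nonneg (D.m i + D.a i) w)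
        have b6 : semi (D.m i + D.a i) w * (D.κ * semi (D.m i + D.a i) w) =
          D.κ * (D.m i w w + D.a i w w) := by rw [← b2]; ring
        have b7 := sq_nonneg (semi (D.m i) g - semi (D.m i) v)
        have b8 := mul_nonneg (sq_nonneg D.κ₀) wa
        rw [hK₁]
        nlinarith
      · simp only [h1, h2, not_false_eq_true, if_true]
        have e1 := D.cut_outside k i h2 w w
        have e2 := D.cut_outside k i h2 w g
        rw [← hv] at e1 e2
        rw [e1.1, e1.2, e2.1]
        have b7 := sq_nonneg (semi (D.m i) g - semi (D.m i) w)
        nlinarith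
  have hsum := Finset.sum_le_sum hpt
  rw [bOn_apply, mOn_apply] at h
  rw [Finset.sum_sub_distrib, Finset.sum_sub_distrib, ← h, sub_self, Finset.sum_ite_mem,
    Finset.sum_ite_mem, Finset.univ_inter, Finset.univ_inter, Finset.sum_add_distrib,
    ← Finset.mul_sum, ← Finset.mul_sum, ← Finset.mul_sum, ← bOn_apply, ← bOn_apply,
    ← mOn_apply] at hsum
  -- Raising K₁ to K adds (K - K₁)(B_{k+1} - B_k) ≤ 0, by monotonicity of the energy in the set.
  have hle : D.bOn (D.S (k + 1))ᶜ w w ≤ D.bOn (D.S k)ᶜ w w :=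
    D.bOn_mono (Finset.compl_subset_compl.2 (D.mono (Nat.le_succ k))) w
  nlinarith

end CutSystem

/-- An inhomogeneous geometric recursion. -/
lemma geometric_recursion {K g t x₀ : ℝ} (hK : 0 ≤ K) (hg : (1 + K) * g = K + 1 / 2)
    (hx₀ : 0 ≤ x₀) (ht : 0 ≤ t) (x : ℕ → ℝ) (h0 : x 0 ≤ x₀)
    (hx : ∀ k, (1 + K) * x (k + 1) ≤ K * x k + (K + 1 / 2) * t * g ^ k) (k : ℕ) :
    x k ≤ g ^ k * (x₀ + k * t) := by
  have hg0 : 0 ≤ g := by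
    by_contra hneg
    push Not at hneg
    nlinarith
  induction k with
  | zero => simpa using h0
  | succ k ih =>
    have h1 : 0 < 1 + K := by linarith
    refine le_of_mul_le_mul_left ((hx k).trans ?_) h1
    have h2 := mul_le_mul_of_nonneg_left ih hK
    have h3 : 0 ≤ g ^ k * (x₀ + k * t) := by positivity
    have h4 : (1 + K) * (g ^ (k + 1) * (x₀ + ((k + 1 : ℕ) : ℝ) * t)) =
        (K + 1 / 2) * (g ^ k * (x₀ + k * t)) + (K + 1 / 2) * t * g ^ k := by
      rw [← hg]; push_cast; ring
    rw [h4]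
    nlinarith

/-- A geometric sum with ratio 2L ≥ 2 is dominated by its last term, so it falls short of the next
power by a factor L. With L = √l this gain cancels the loss from summing the forcing over l layers.
-/
lemma sum_pow_two_mul_le {L : ℝ} (hL : 1 ≤ L) (j : ℕ) :
    L * ∑ i ∈ Finset.range j, (2 * L) ^ i ≤ (2 * L) ^ j := by
  induction j with
  | zero => simp
  | succ j ih =>
    rw [Finset.sum_range_succ, mul_add, pow_succ]
    nlinarith [pow_pos (by linarith : 0 < 2 * L) j]

/-- Absorbs the cubic loss of the energy estimate into a larger base. Passing from n to n + 1, the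
cube grows by a factor of at most 3/2 once n ≥ 7; the smaller cases are checked by computation. -/
lemma cube_mul_two_pow_le (n : ℕ) : (n + 1) ^ 3 * 2 ^ n ≤ 64 * 3 ^ n := by
  have big : ∀ n, 7 ≤ n → (n + 1) ^ 3 * 2 ^ n ≤ 64 * 3 ^ n := by
    intro n hn
    induction n, hn using Nat.le_induction with
    | base => norm_num
    | succ n hn ih =>
      have h : 2 * (n + 1 + 1) ^ 3 ≤ 3 * (n + 1) ^ 3 := by
        obtain ⟨k, rfl⟩ := Nat.exists_eq_add_of_le hn
        nlinarith [sq_nonneg k]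
      calc (n + 1 + 1) ^ 3 * 2 ^ (n + 1) = 2 * (n + 1 + 1) ^ 3 * 2 ^ n := by ring
        _ ≤ 3 * (n + 1) ^ 3 * 2 ^ n := Nat.mul_le_mul_right _ h
        _ = 3 * ((n + 1) ^ 3 * 2 ^ n) := by ring
        _ ≤ 3 * (64 * 3 ^ n) := Nat.mul_le_mul_left _ ih
        _ = 64 * 3 ^ (n + 1) := by ring
  rcases le_or_gt 7 n with h | h
  · exact big n h
  · interval_cases n <;> norm_num

namespace CutSystem

variable {V ι : Type*} [AddCommGroup V] [Module ℝ V] [Fintype ι] [DecidableEq ι]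
  (D : CutSystem V ι)

/-- Decay of a discrete solution with data on `S 0`, away from its data. -/
lemma solution_decay (z : ℕ → V) (K γ M : ℝ) (l N : ℕ) (hl : 1 ≤ l)
    (hK : 2 * D.κ + D.κ₀ ^ 2 ≤ K) (hK' : 256 ≤ K) (hγ0 : 0 ≤ γ)
    (hγ : (1 + K) * γ ^ 2 = K + 1 / 2)
    (h0 : semi (D.bOn (D.S 0)ᶜ) (z 0) = 0) (h1 : semi (D.bOn (D.S 0)ᶜ) (z 1) = 0)
    (heq : ∀ n k v, D.bOn Finset.univ ((1 / 4 : ℝ) • sig z n) (D.Z k v) =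
      D.mOn Finset.univ (z (n + 1)) (D.Z k v))
    (hM0 : 0 ≤ M) (hM : ∀ j ≤ N, semi (D.bOn Finset.univ) (half z j) ≤ M) :
    ∀ j ≤ N, ∀ k ≤ l, semi (D.bOn (D.S k)ᶜ) (half z j) ≤
      8 * (2 * Real.sqrt l) ^ j * γ ^ k * M := by
  set L := Real.sqrt l with hLdef
  have hL : 1 ≤ L := Real.one_le_sqrt.2 (by exact_mod_cast hl)
  have hLs : L ^ 2 = l := Real.sq_sqrt (Nat.cast_nonneg l)
  have hsub : ∀ k v, semi (D.bOn (D.S k)ᶜ) v ≤ semi (D.bOn (D.S 0)ᶜ) v := fun k v =>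
    semi_le_semi (D.bOn_mono (Finset.compl_subset_compl.2 (D.mono (Nat.zero_le k))) v)
  have hz0 : ∀ k, semi (D.bOn (D.S k)ᶜ) (z 0) = 0 := fun k =>
    le_antisymm ((hsub k _).trans h0.le) (semi_nonneg _ _)
  have hz1 : ∀ k, semi (D.bOn (D.S k)ᶜ) (z 1) = 0 := fun k =>
    le_antisymm ((hsub k _).trans h1.le) (semi_nonneg _ _)
  intro j
  induction j using Nat.strong_induction_on with
  | _ j ih =>
  intro hj k hk
  rcases j with _ | j
  · have e : semi (D.bOn (D.S k)ᶜ) (half z 0) ≤ 0 := by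
      unfold half
      rw [semi_smul]
      have := semi_add_le (D.bOn_psd (D.S k)ᶜ) (z (0 + 1)) (z 0)
      rw [zero_add, hz0, hz1, add_zero] at this
      exact mul_nonpos_of_nonneg_of_nonpos (abs_nonneg _) this
    exact e.trans (by positivity)
  · set X := (2 * L) ^ (j + 1) with hX
    have hX1 : 1 ≤ X := one_le_pow₀ (by linarith)
    -- The forcing is an alternating sum of the half steps with index at most j, to which the
    -- induction hypothesis applies.
    have hs : ∀ k ≤ l, semi (D.mOn (D.S k)ᶜ) (z (j + 1)) ≤ 16 * X / L * (γ ^ k * M) := by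
      intro k hk
      have hm0 : semi (D.mOn (D.S k)ᶜ) (z 0) = 0 :=
        le_antisymm ((D.mOn_le_bOn _ _).trans (hz0 k).le) (semi_nonneg _ _)
      refine (semi_le_sum_half (D.mOn_psd _) z hm0 (j + 1)).trans ?_
      have e1 : ∑ i ∈ Finset.range (j + 1), semi (D.mOn (D.S k)ᶜ) (half z i) ≤
          ∑ i ∈ Finset.range (j + 1), (2 * L) ^ i * (8 * (γ ^ k * M)) := by
        refine Finset.sum_le_sum fun i hi => (D.mOn_le_bOn _ _).trans ?_
        have hi' := Finset.mem_range.1 hi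
        refine (ih i hi' (by omega) k hk).trans (le_of_eq (by ring))
      rw [← Finset.sum_mul] at e1
      have e2 : ∑ i ∈ Finset.range (j + 1), (2 * L) ^ i ≤ X / L := by
        rw [le_div_iff₀ (by linarith), mul_comm]
        exact sum_pow_two_mul_le hL (j + 1)
      have e3 : 0 ≤ 8 * (γ ^ k * M) := by positivity
      calc _ ≤ 2 * (X / L * (8 * (γ ^ k * M))) := by
            have := mul_le_mul_of_nonneg_right e2 e3
            linarith
        _ = _ := by ring
    set w := (1 / 4 : ℝ) • sig z j with hw
    have hwh : w = (1 / 2 : ℝ) • (half z (j + 1) + half z j) := by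
      rw [hw, sig_eq]; module
    have hx0 : D.bOn Finset.univ w w ≤ M ^ 2 := by
      rw [← semi_sq (D.bOn_psd _)]
      apply pow_le_pow_left₀ (semi_nonneg _ _)
      rw [hwh, semi_smul, abs_of_pos (by norm_num)]
      have := semi_add_le (D.bOn_psd Finset.univ) (half z (j + 1)) (half z j)
      linarith [hM (j + 1) hj, hM j (by omega)]
    -- The squared forcing off `S k` is at most 256 t γ^{2k}, and 256 ≤ K fits it into the
    -- recursion; by L² = l the product l t is exactly X² M².
    set t := (16 * X / L * M) ^ 2 / 256 with ht
    have hrec := geometric_recursion (K := K) (g := γ ^ 2) (t := t) (x₀ := M ^ 2) (by linarith) hγ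
      (sq_nonneg M) (by positivity)
      -- The recursion is required for every k, the forcing is controlled for k ≤ l only; the
      -- sequence is therefore continued by zero beyond l.
      (fun k => D.bOn (D.S (min k l))ᶜ w w * (if k ≤ l then 1 else 0))
      (by
        simp only [Nat.zero_min, zero_le, if_true, mul_one]
        exact (D.bOn_mono (Finset.subset_univ _) w).trans hx0)
      (by
        intro k
        by_cases hkl : k + 1 ≤ l
        · have hkl' : k ≤ l := by omega
          simp only [hkl, hkl', min_eq_left, if_true, mul_one]
          have s1 := D.decay_step w (z (j + 1)) k K hK (heq j k w)
          have s2 : D.mOn (D.S k)ᶜ (z (j + 1)) (z (j + 1)) ≤ 256 * t * (γ ^ 2) ^ k := by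
            rw [← semi_sq (D.mOn_psd _)]
            refine (pow_le_pow_left₀ (semi_nonneg _ _) (hs k hkl') 2).trans (le_of_eq ?_)
            rw [ht, ← pow_mul, mul_comm 2 k, pow_mul]; ring
          have s3 : 0 ≤ t * (γ ^ 2) ^ k := by positivity
          nlinarith
        · simp only [hkl, if_false, mul_zero]
          have n1 := (D.bOn_psd (D.S (min k l))ᶜ).nonneg w
          have n2 : (0 : ℝ) ≤ if k ≤ l then 1 else 0 := by split_ifs <;> norm_num
          have n3 : 0 ≤ K := by linarith
          positivity) k
    simp only [hk, min_eq_left, if_true, mul_one] at hrec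
    have hkt : k * t ≤ X ^ 2 * M ^ 2 := by
      have e1 : (l : ℝ) * t = X ^ 2 * M ^ 2 := by
        rw [← hLs, ht]
        have : L ≠ 0 := by linarith
        field_simp
        ring
      rw [← e1]
      exact mul_le_mul_of_nonneg_right (by exact_mod_cast hk) (by positivity)
    have hwk : semi (D.bOn (D.S k)ᶜ) w ≤ γ ^ k * (M * (1 + X)) := by
      apply Real.sqrt_le_iff.2 ⟨by positivity, hrec.trans ?_⟩
      rw [mul_pow, ← pow_mul, ← pow_mul, mul_comm 2 k]
      apply mul_le_mul_of_nonneg_left _ (by positivity)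
      nlinarith [mul_nonneg (sq_nonneg M) (by linarith : 0 ≤ X)]
    -- This fixes the constant 8: 2(1 + X) from 2w and 8 · X/2 from the previous half step add up to
    -- 2 + 6X ≤ 8X.
    have e : half z (j + 1) = (2 : ℝ) • w - half z j := by rw [hwh]; module
    rw [e]
    have f1 := semi_sub_le (D.bOn_psd (D.S k)ᶜ) ((2 : ℝ) • w) (half z j)
    rw [semi_smul, abs_of_pos two_pos] at f1
    have f2 := ih j (by omega) (by omega) k hk
    have f3 : (2 * L) ^ j ≤ X / 2 := by
      rw [hX, pow_succ]
      nlinarith [pow_pos (by linarith : 0 < 2 * L) j]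
    have f4 : 0 ≤ γ ^ k * M := by positivity
    have f5 := mul_le_mul_of_nonneg_right f3 f4
    have f6 := mul_le_mul_of_nonneg_right hX1 f4
    nlinarith

/-- The localization error of the Crank–Nicolson scheme, for an abstract cut-off system. -/
theorem localization_error (z z' : ℕ → V) (W : Submodule ℝ V) (K γ M : ℝ) (l N : ℕ)
    (hK : 2 * D.κ + D.κ₀ ^ 2 ≤ K) (hK' : 256 ≤ K) (hγ0 : 0 ≤ γ)
    (hγ : (1 + K) * γ ^ 2 = K + 1 / 2)
    (h0 : semi (D.bOn (D.S 0)ᶜ) (z 0) = 0) (h1 : semi (D.bOn (D.S 0)ᶜ) (z 1) = 0)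
    (heq : ∀ n k v, D.bOn Finset.univ ((1 / 4 : ℝ) • sig z n) (D.Z k v) =
      D.mOn Finset.univ (z (n + 1)) (D.Z k v))
    (hM : ∀ j ≤ N, semi (D.bOn Finset.univ) (half z j) ≤ M)
    (hz' : ∀ n, z' n ∈ W) (hcut : ∀ v, v - D.Z l v ∈ W)
    (heqW : ∀ n, ∀ v ∈ W, D.mOn Finset.univ (del (fun n => z n - z' n) n) v +
      D.aOn Finset.univ (sig (fun n => z n - z' n) n) v = 0)
    (e0 : z' 0 = z 0) (e1 : z' 1 = z 1) :
    semi (D.bOn Finset.univ) (half (fun n => z n - z' n) N) ≤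
      16384 * K * (3 * Real.sqrt (l + 1 : ℕ)) ^ N * γ ^ (l + 1) * M := by
  have hM0 : 0 ≤ M := (semi_nonneg _ _).trans (hM 0 (Nat.zero_le _))
  have hdec := D.solution_decay z K γ M (l + 1) N (by omega) hK hK' hγ0 hγ h0 h1 heq hM0 hM
  set L := Real.sqrt (l + 1 : ℕ) with hL
  have hL1 : 1 ≤ L := Real.one_le_sqrt.2 (by exact_mod_cast Nat.le_add_left 1 l)
  have hκ : 0 ≤ D.κ := zero_le_one.trans D.one_le
  have hZ : ∀ v, semi (D.bOn Finset.univ) (D.Z l v) ≤ D.κ * semi (D.bOn (D.S l)ᶜ) v := by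
    intro v
    apply Real.sqrt_le_iff.2 ⟨mul_nonneg hκ (semi_nonneg _ _), ?_⟩
    rw [mul_pow, semi_sq (D.bOn_psd _), bOn_apply, bOn_apply, Finset.mul_sum,
      ← Finset.sum_subset (Finset.subset_univ (D.S l)ᶜ)]
    · refine Finset.sum_le_sum fun i _ => (D.cut_b l i v).trans ?_
      have := (D.ha i).nonneg v
      nlinarith [mul_nonneg (sq_nonneg D.κ) this]
    · intro i _ hi
      have hi' : i ∈ D.S l := by simpa using hi
      have := D.cut_inside l i hi' v (D.Z l v)
      rw [this.1, this.2, add_zero]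
  -- The far part r of the solution is small by the decay; the remainder θ of the error lies in W
  -- and may be used as a test function. Both vanish in the seminorm at the first two steps, since
  -- the initial data live on `S 0`.
  set r : ℕ → V := fun n => D.Z l (z n) with hr
  set θ : ℕ → V := fun n => (z n - D.Z l (z n)) - z' n with hθ
  have hrθ : ∀ n, r n + θ n = z n - z' n := fun n => by simp only [hr, hθ]; abel
  have hrz : ∀ n, semi (D.bOn (D.S 0)ᶜ) (z n) = 0 → semi (D.bOn Finset.univ) (r n) = 0 := by
    intro n hn
    apply le_antisymm _ (semi_nonneg _ _)
    refine (hZ (z n)).trans ?_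
    have := semi_le_semi
      (D.bOn_mono (Finset.compl_subset_compl.2 (D.mono (Nat.zero_le l))) (z n))
    exact mul_nonpos_of_nonneg_of_nonpos hκ (this.trans (le_of_eq hn))
  set ϱ := D.κ * (8 * (2 * L) ^ N * γ ^ l * M) with hϱ
  have hϱ0 : 0 ≤ ϱ := by positivity
  have hR : ∀ j ≤ N, semi (D.mOn Finset.univ + D.aOn Finset.univ) (half r j) ≤ ϱ := by
    intro j hj
    have e : half r j = D.Z l (half z j) := by simp [half, hr]
    rw [e, ← bOn_eq]
    refine (hZ _).trans (mul_le_mul_of_nonneg_left ?_ hκ)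
    refine (hdec j hj l (Nat.le_succ l)).trans ?_
    have : (2 * L) ^ j ≤ (2 * L) ^ N := pow_le_pow_right₀ (by linarith) hj
    have h8 : 0 ≤ 8 * (γ ^ l * M) := by positivity
    nlinarith [mul_le_mul_of_nonneg_right this h8]
  have hbound := energy_bound (D.mOn_psd Finset.univ) (D.aOn_psd Finset.univ) W r θ
    (fun n => W.sub_mem (hcut _) (hz' n))
    (by
      intro n v hv
      have := heqW n v hv
      have d1 : del r n + del θ n = del (fun n => z n - z' n) n := by
        simp only [del, hr, hθ]; module
      have d2 : sig r n + sig θ n = sig (fun n => z n - z' n) n := by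
        simp only [sig, hr, hθ]; module
      rw [d1, d2]; exact this)
    (by rw [hrθ, e0, sub_self]) (by rw [hrθ, e1, sub_self])
    (by rw [← bOn_eq]; exact hrz 0 h0) (by rw [← bOn_eq]; exact hrz 1 h1) N ϱ hϱ0 hR
  rw [← bOn_eq] at hbound
  simp only [hrθ] at hbound
  refine hbound.trans ?_
  -- The cut-off sits at layer l, one layer inside the local domain, so the decay supplies γ^l only.
  -- As γ ≥ 1/2, the missing factor costs 2, whence 16384 = 2 · 16 · 8 · 64.
  have hγh : 1 ≤ 2 * γ := by
    by_contra hlt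
    push Not at hlt
    have : γ ^ 2 ≤ 1 / 4 := by nlinarith
    nlinarith
  have hcube : ((N : ℝ) + 1) ^ 3 * 2 ^ N ≤ 64 * 3 ^ N := by
    exact_mod_cast cube_mul_two_pow_le N
  have hκK : D.κ ≤ K := by nlinarith [sq_nonneg D.κ₀]
  calc 16 * ((N : ℝ) + 1) ^ 3 * ϱ
      = 128 * D.κ * ((((N : ℝ) + 1) ^ 3 * 2 ^ N) * (L ^ N * γ ^ l * M)) := by
        rw [hϱ, mul_pow]; ring
    _ ≤ 128 * K * ((64 * 3 ^ N) * (L ^ N * γ ^ l * M)) := by gcongr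
    _ = 8192 * K * (3 * L) ^ N * γ ^ l * M * 1 := by rw [mul_pow]; ring
    _ ≤ 8192 * K * (3 * L) ^ N * γ ^ l * M * (2 * γ) := by
        apply mul_le_mul_of_nonneg_left hγh
        have : 0 ≤ K := by linarith
        positivity
    _ = _ := by ring

end CutSystem

end Localization

/-! ### Q₁ functions on the reference cube. -/

section MultiAffine

variable {d : ℕ}

/-- Functions on `ℝ^d` that are affine in each coordinate separately. -/
def SepAffine (g : (Fin d → ℝ) → ℝ) : Prop :=
  ∀ t k s, g (Function.update t k s) =
    (1 - s) * g (Function.update t k 0) + s * g (Function.update t k 1)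

/-- The vertex of the unit cube with the given set of coordinates equal to `1`. -/
def corner (σ : Fin d → Bool) : Fin d → ℝ := fun k => if σ k then 1 else 0

/-- The `Q₁` shape function of a vertex of the unit cube. -/
def shape (σ : Fin d → Bool) (t : Fin d → ℝ) : ℝ := ∏ k, if σ k then t k else 1 - t k

/-- The `Q₁` function with given vertex values. -/
def qint (a : (Fin d → Bool) → ℝ) (t : Fin d → ℝ) : ℝ := ∑ σ, a σ * shape σ t

lemma sepAffine_prod (f : Fin d → ℝ → ℝ) (hf : ∀ k s, f k s = (1 - s) * f k 0 + s * f k 1) :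
    SepAffine (fun t => ∏ k, f k (t k)) := by
  intro t k s
  have h : ∀ r, ∏ j, f j (Function.update t k r j) =
      f k r * ∏ j ∈ Finset.univ.erase k, f j (t j) := by
    intro r
    rw [← Finset.mul_prod_erase Finset.univ _ (Finset.mem_univ k), Function.update_self]
    congr 1
    refine Finset.prod_congr rfl fun j hj => ?_
    rw [Function.update_of_ne (Finset.ne_of_mem_erase hj)]
  simp only [h]
  rw [hf k s]; ring

lemma SepAffine.sum {ι : Type*} (J : Finset ι) (c : ι → ℝ) (g : ι → (Fin d → ℝ) → ℝ)
    (hg : ∀ i ∈ J, SepAffine (g i)) : SepAffine (fun t => ∑ i ∈ J, c i * g i t) := by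
  intro t k s
  simp only [Finset.mul_sum]
  rw [← Finset.sum_add_distrib]
  refine Finset.sum_congr rfl fun i hi => ?_
  rw [hg i hi t k s]; ring

lemma SepAffine.sub {g g' : (Fin d → ℝ) → ℝ} (hg : SepAffine g) (hg' : SepAffine g') :
    SepAffine (fun t => g t - g' t) := by
  intro t k s
  simp only
  rw [hg t k s, hg' t k s]; ring

lemma sepAffine_shape (σ : Fin d → Bool) : SepAffine (shape σ) :=
  sepAffine_prod (fun k s => if σ k then s else 1 - s) fun k s => by split_ifs <;> simp

lemma sepAffine_qint (a : (Fin d → Bool) → ℝ) : SepAffine (qint a) :=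
  SepAffine.sum _ _ _ fun _ _ => sepAffine_shape _

lemma sepAffine_eval (p : MvPolynomial (Fin d) ℝ) (hp : ∀ k, p.degreeOf k ≤ 1) :
    SepAffine (fun t => MvPolynomial.eval t p) := by
  simp only [MvPolynomial.eval_eq']
  refine SepAffine.sum _ _ _ fun m hm => sepAffine_prod (fun k s => s ^ m k) fun k s => ?_
  have h : m k ≤ 1 := (MvPolynomial.monomial_le_degreeOf k hm).trans (hp k)
  interval_cases m k <;> simp

/-- The coordinates are freed one at a time: along the freed coordinate the function is affine with
zero end values. -/
lemma SepAffine.eq_zero {g : (Fin d → ℝ) → ℝ} (hg : SepAffine g) (h : ∀ σ, g (corner σ) = 0)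
    (t : Fin d → ℝ) : g t = 0 := by
  have key : ∀ J : Finset (Fin d), ∀ t : Fin d → ℝ, (∀ k ∉ J, t k = 0 ∨ t k = 1) → g t = 0 := by
    intro J
    induction J using Finset.induction_on with
    | empty =>
      intro t ht
      have : t = corner (fun k => decide (t k = 1)) := by
        funext k
        rcases ht k (Finset.notMem_empty k) with h0 | h0 <;> simp [corner, h0]
      rw [this]; exact h _
    | insert k J hk ih =>
      intro t ht
      have e := hg t k (t k)
      rw [Function.update_eq_self] at e
      have hz : ∀ r : ℝ, (r = 0 ∨ r = 1) → g (Function.update t k r) = 0 := by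
        intro r hr
        apply ih
        intro j hj
        by_cases hjk : j = k
        · subst hjk; simpa using hr
        · rw [Function.update_of_ne hjk]
          exact ht j (by simp [hjk, hj])
      rw [e, hz 0 (Or.inl rfl), hz 1 (Or.inr rfl)]; simp
  exact key Finset.univ t (by simp)

lemma shape_corner_self (σ : Fin d → Bool) : shape σ (corner σ) = 1 := by
  refine Finset.prod_eq_one fun k _ => ?_
  by_cases h : σ k <;> simp [corner, h]

lemma shape_corner_of_ne {σ σ' : Fin d → Bool} (h : σ ≠ σ') : shape σ (corner σ') = 0 := by
  obtain ⟨k, hk⟩ := Function.ne_iff.1 h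
  refine Finset.prod_eq_zero (Finset.mem_univ k) ?_
  cases h1 : σ k <;> cases h2 : σ' k <;> simp_all [corner]

lemma qint_corner (a : (Fin d → Bool) → ℝ) (σ : Fin d → Bool) : qint a (corner σ) = a σ := by
  unfold qint
  rw [Finset.sum_eq_single σ]
  · rw [shape_corner_self, mul_one]
  · intro σ' _ h; rw [shape_corner_of_ne h, mul_zero]
  · simp

lemma SepAffine.eq_qint {g : (Fin d → ℝ) → ℝ} (hg : SepAffine g) (t : Fin d → ℝ) :
    g t = qint (fun σ => g (corner σ)) t := by
  have := (hg.sub (sepAffine_qint fun σ => g (corner σ))).eq_zero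
    (fun σ => by rw [qint_corner, sub_self]) t
  linarith

lemma corner_mem (σ : Fin d → Bool) : corner σ ∈ Set.Icc (0 : Fin d → ℝ) 1 := by
  constructor <;> intro k <;> by_cases h : σ k <;> simp [corner, h]

lemma shape_eq_eval (σ : Fin d → Bool) (t : Fin d → ℝ) :
    shape σ t = MvPolynomial.eval t
      (∏ k, if σ k then MvPolynomial.X k else 1 - MvPolynomial.X k : MvPolynomial (Fin d) ℝ) := by
  rw [map_prod]
  refine Finset.prod_congr rfl fun k _ => ?_
  split_ifs <;> simp

lemma exists_poly_qint (a : (Fin d → Bool) → ℝ) :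
    ∃ p : MvPolynomial (Fin d) ℝ, (∀ k, p.degreeOf k ≤ 1) ∧
      ∀ t, qint a t = MvPolynomial.eval t p := by
  refine ⟨∑ σ, MvPolynomial.C (a σ) *
    ∏ k, (if σ k then MvPolynomial.X k else 1 - MvPolynomial.X k), fun k => ?_, fun t => ?_⟩
  · refine (MvPolynomial.degreeOf_sum_le k _ _).trans (Finset.sup_le fun σ _ => ?_)
    refine (MvPolynomial.degreeOf_C_mul_le _ _ _).trans ?_
    refine (MvPolynomial.degreeOf_prod_le _ _ _).trans ?_
    have hle : ∀ j ∈ (Finset.univ : Finset (Fin d)), MvPolynomial.degreeOf k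
        (if σ j then MvPolynomial.X j else 1 - MvPolynomial.X j : MvPolynomial (Fin d) ℝ) ≤
        if k = j then 1 else 0 := by
      intro j _
      have hX : MvPolynomial.degreeOf k (MvPolynomial.X j : MvPolynomial (Fin d) ℝ) ≤
          if k = j then 1 else 0 := by
        rw [MvPolynomial.degreeOf_X]
      cases σ j
      · simp only [Bool.false_eq_true, if_false]
        refine (MvPolynomial.degreeOf_sub_le _ _ _).trans (max_le ?_ hX)
        simp
      · simpa using hX
    refine (Finset.sum_le_sum hle).trans ?_
    simp
  · rw [map_sum]
    refine Finset.sum_congr rfl fun σ _ => ?_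
    rw [map_mul, MvPolynomial.eval_C, shape_eq_eval]

lemma qint_add (a b : (Fin d → Bool) → ℝ) (t : Fin d → ℝ) :
    qint (a + b) t = qint a t + qint b t := by
  simp [qint, add_mul, Finset.sum_add_distrib]

lemma qint_smul (c : ℝ) (a : (Fin d → Bool) → ℝ) (t : Fin d → ℝ) :
    qint (c • a) t = c * qint a t := by
  simp [qint, Finset.mul_sum, mul_assoc]

/-- Telescoping, one factor at a time; it yields the Lipschitz bound for the shape functions. -/
lemma abs_prod_sub_prod_le {ι : Type*} (J : Finset ι) (x y : ι → ℝ) (hx : ∀ i, |x i| ≤ 1)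
    (hy : ∀ i, |y i| ≤ 1) : |∏ i ∈ J, x i - ∏ i ∈ J, y i| ≤ ∑ i ∈ J, |x i - y i| := by
  classical
  induction J using Finset.induction_on with
  | empty => simp
  | insert k J hk ih =>
    rw [Finset.prod_insert hk, Finset.prod_insert hk, Finset.sum_insert hk]
    have hp : |∏ i ∈ J, x i| ≤ 1 := by
      rw [Finset.abs_prod]; exact Finset.prod_le_one (fun i _ => abs_nonneg _) fun i _ => hx i
    calc |x k * ∏ i ∈ J, x i - y k * ∏ i ∈ J, y i|
        = |(x k - y k) * ∏ i ∈ J, x i + y k * (∏ i ∈ J, x i - ∏ i ∈ J, y i)| := by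
          congr 1; ring
      _ ≤ |x k - y k| * |∏ i ∈ J, x i| + |y k| * |∏ i ∈ J, x i - ∏ i ∈ J, y i| := by
          rw [← abs_mul, ← abs_mul]; exact abs_add_le _ _
      _ ≤ |x k - y k| * 1 + 1 * ∑ i ∈ J, |x i - y i| := by
          gcongr
          exact hy k
      _ = _ := by ring

lemma abs_shape_le_one (σ : Fin d → Bool) {t : Fin d → ℝ} (ht : t ∈ Set.Icc (0 : Fin d → ℝ) 1) :
    |shape σ t| ≤ 1 := by
  unfold shape
  rw [Finset.abs_prod]
  refine Finset.prod_le_one (fun i _ => abs_nonneg _) fun k _ => ?_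
  have h0 := ht.1 k
  have h1 := ht.2 k
  simp only [Pi.zero_apply, Pi.one_apply] at h0 h1
  split_ifs <;> rw [abs_le] <;> constructor <;> linarith

lemma abs_qint_le (a : (Fin d → Bool) → ℝ) {t : Fin d → ℝ} (ht : t ∈ Set.Icc (0 : Fin d → ℝ) 1) :
    |qint a t| ≤ ∑ σ, |a σ| := by
  refine (Finset.abs_sum_le_sum_abs _ _).trans (Finset.sum_le_sum fun σ _ => ?_)
  rw [abs_mul]
  exact mul_le_of_le_one_right (abs_nonneg _) (abs_shape_le_one σ ht)

lemma abs_qint_sub_le (a : (Fin d → Bool) → ℝ) {t s : Fin d → ℝ}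
    (ht : t ∈ Set.Icc (0 : Fin d → ℝ) 1) (hs : s ∈ Set.Icc (0 : Fin d → ℝ) 1) :
    |qint a t - qint a s| ≤ (∑ σ, |a σ|) * ∑ k, |t k - s k| := by
  unfold qint
  rw [← Finset.sum_sub_distrib, Finset.sum_mul]
  refine (Finset.abs_sum_le_sum_abs _ _).trans (Finset.sum_le_sum fun σ _ => ?_)
  rw [← mul_sub, abs_mul]
  refine mul_le_mul_of_nonneg_left ?_ (abs_nonneg _)
  have hb : ∀ t : Fin d → ℝ, t ∈ Set.Icc (0 : Fin d → ℝ) 1 → ∀ k,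
      |if σ k then t k else 1 - t k| ≤ 1 := by
    intro t ht k
    have h0 := ht.1 k
    have h1 := ht.2 k
    simp only [Pi.zero_apply, Pi.one_apply] at h0 h1
    split_ifs <;> rw [abs_le] <;> constructor <;> linarith
  refine (abs_prod_sub_prod_le _ _ _ (hb t ht) (hb s hs)).trans (Finset.sum_le_sum fun k _ => ?_)
  split_ifs
  · exact le_rfl
  · rw [show 1 - t k - (1 - s k) = -(t k - s k) by ring, abs_neg]

lemma contDiff_shape (σ : Fin d → Bool) : ContDiff ℝ 1 (shape σ) := by
  refine contDiff_prod fun k _ => ?_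
  split_ifs <;> fun_prop

lemma contDiff_qint (a : (Fin d → Bool) → ℝ) : ContDiff ℝ 1 (qint a) :=
  ContDiff.sum fun σ _ => contDiff_const.mul (contDiff_shape σ)

lemma cube_subset_closure_interior :
    Set.Icc (0 : Fin d → ℝ) 1 ⊆ closure (interior (Set.Icc (0 : Fin d → ℝ) 1)) := by
  rw [← Set.pi_univ_Icc, interior_pi_set Set.finite_univ, closure_pi_set]
  refine Set.pi_mono fun k _ => ?_
  simp [closure_Ioo]

/-- On `Q₁`, the Euclidean norm of the vertex values is controlled by the `L²` norm. -/
lemma exists_sum_sq_le_integral (d : ℕ) : ∃ c : ℝ, 0 < c ∧ ∀ a : (Fin d → Bool) → ℝ,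
    ∑ σ, a σ ^ 2 ≤ c * ∫ t in Set.Icc (0 : Fin d → ℝ) 1, qint a t ^ 2 := by
  set Q : ((Fin d → Bool) → ℝ) → ℝ := fun a => ∫ t in Set.Icc (0 : Fin d → ℝ) 1, qint a t ^ 2
  have hcpt : IsCompact (Set.Icc (0 : Fin d → ℝ) 1) := isCompact_Icc
  have hint : ∀ g : (Fin d → ℝ) → ℝ, Continuous g → IntegrableOn g (Set.Icc 0 1) := fun g hg =>
    hg.continuousOn.integrableOn_compact hcpt
  have hQ : ∀ a, Q a = ∑ σ, ∑ σ', a σ * a σ' *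
      ∫ t in Set.Icc (0 : Fin d → ℝ) 1, shape σ t * shape σ' t := by
    intro a
    have e : ∀ t, qint a t ^ 2 = ∑ σ, ∑ σ', a σ * a σ' * (shape σ t * shape σ' t) := by
      intro t
      rw [sq, qint, Finset.sum_mul_sum]
      refine Finset.sum_congr rfl fun σ _ => Finset.sum_congr rfl fun σ' _ => by ring
    have hc : ∀ σ σ', Continuous fun t : Fin d → ℝ => a σ * a σ' * (shape σ t * shape σ' t) :=
      fun σ σ' => continuous_const.mul
        ((contDiff_shape σ).continuous.mul (contDiff_shape σ').continuous)
    simp only [Q, e]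
    rw [integral_finsetSum _ fun σ _ => hint _ (continuous_finsetSum _ fun σ' _ => hc σ σ')]
    refine Finset.sum_congr rfl fun σ _ => ?_
    rw [integral_finsetSum _ fun σ' _ => hint _ (hc σ σ')]
    exact Finset.sum_congr rfl fun σ' _ => integral_const_mul _ _
  have hQc : Continuous Q := by
    rw [show Q = _ from funext hQ]
    fun_prop
  have hpos : ∀ a, a ≠ 0 → 0 < Q a := by
    intro a ha
    refine lt_of_le_of_ne (integral_nonneg fun t => sq_nonneg _) fun h0 => ha ?_
    have hcont : Continuous fun t => qint a t ^ 2 := (contDiff_qint a).continuous.pow 2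
    have hae := (integral_eq_zero_iff_of_nonneg (fun t => sq_nonneg (qint a t))
      (hint _ hcont)).1 h0.symm
    -- Almost everywhere zero and continuous on the closure of an open set means zero everywhere
    -- there, in particular at the corners, where the values are the coefficients.
    have heq : Set.EqOn (fun t => qint a t ^ 2) 0 (Set.Icc 0 1) :=
      Measure.eqOn_of_ae_eq hae hcont.continuousOn continuousOn_const cube_subset_closure_interior
    funext σ
    have := heq (corner_mem σ)
    simpa [qint_corner] using this
  -- Equivalence of norms in finite dimension: minimize Q on the unit sphere and use that Q is
  -- homogeneous of degree two.
  have hne : (Metric.sphere (0 : (Fin d → Bool) → ℝ) 1).Nonempty :=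
    NormedSpace.sphere_nonempty.2 zero_le_one
  obtain ⟨a₀, ha₀, hmin⟩ := (isCompact_sphere (0 : (Fin d → Bool) → ℝ) 1).exists_isMinOn hne
    hQc.continuousOn
  have ha₀n : ‖a₀‖ = 1 := by simpa using ha₀
  have hδ : 0 < Q a₀ := hpos a₀ (by intro h; simp [h] at ha₀n)
  have hcard : 0 < (Fintype.card (Fin d → Bool) : ℝ) := by
    exact_mod_cast Fintype.card_pos
  refine ⟨Fintype.card (Fin d → Bool) / Q a₀, div_pos hcard hδ, fun a => ?_⟩
  have hsum : ∑ σ, a σ ^ 2 ≤ Fintype.card (Fin d → Bool) * ‖a‖ ^ 2 := by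
    have : ∑ σ, a σ ^ 2 ≤ ∑ _σ : Fin d → Bool, ‖a‖ ^ 2 := by
      refine Finset.sum_le_sum fun σ _ => ?_
      rw [← sq_abs]
      exact pow_le_pow_left₀ (abs_nonneg _) (norm_le_pi_norm a σ) 2
    simpa using this
  have hlow : Q a₀ * ‖a‖ ^ 2 ≤ Q a := by
    rcases eq_or_ne a 0 with rfl | ha
    · simpa using integral_nonneg fun t => sq_nonneg (qint (0 : (Fin d → Bool) → ℝ) t)
    · have hn : 0 < ‖a‖ := norm_pos_iff.2 ha
      have h1 : Q a₀ ≤ Q (‖a‖⁻¹ • a) := hmin (by simp [norm_smul, hn.ne'])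
      have h2 : Q (‖a‖⁻¹ • a) = (‖a‖⁻¹) ^ 2 * Q a := by
        simp only [Q, qint_smul, mul_pow]
        exact integral_const_mul _ _
      rw [h2] at h1
      calc Q a₀ * ‖a‖ ^ 2 ≤ (‖a‖⁻¹) ^ 2 * Q a * ‖a‖ ^ 2 := by gcongr
        _ = Q a := by field_simp
  calc ∑ σ, a σ ^ 2 ≤ Fintype.card (Fin d → Bool) * ‖a‖ ^ 2 := hsum
    _ = Fintype.card (Fin d → Bool) / Q a₀ * (Q a₀ * ‖a‖ ^ 2) := by field_simp
    _ ≤ _ := by gcongr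

end MultiAffine

/-! ### Affine coordinates, elements as convex bodies, and integration over them. -/

namespace Mesh

variable {d : ℕ} (T : Mesh d)

/-- The basis of `ℝ^d` formed by the edge vectors of an element. -/
def edgeBasis (i : Fin T.card) : Module.Basis (Fin d) ℝ (E d) :=
  Module.Basis.mk (T.nondegenerate i)
    ((T.nondegenerate i).span_eq_top_of_card_eq_finrank' (by simp)).ge

/-- The linear part of the affine coordinates of an element. -/
def linCoord (i : Fin T.card) : E d ≃L[ℝ] (Fin d → ℝ) :=
  (T.edgeBasis i).equivFun.toContinuousLinearEquiv

/-- The affine coordinates of an element. -/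
def coord (i : Fin T.card) (x : E d) : Fin d → ℝ := T.linCoord i (x - T.base i)

/-- The chart of an element. -/
def chart (i : Fin T.card) (t : Fin d → ℝ) : E d := affChart (T.base i) (T.edge i) t

variable {T} {i j : Fin T.card}

lemma linCoord_symm_apply (t : Fin d → ℝ) : (T.linCoord i).symm t = ∑ k, t k • T.edge i k := by
  have h : (T.linCoord i).symm t = (T.edgeBasis i).equivFun.symm t := rfl
  rw [h, Module.Basis.equivFun_symm_apply]
  simp [edgeBasis]

lemma chart_eq (t : Fin d → ℝ) : T.chart i t = T.base i + (T.linCoord i).symm t := by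
  rw [linCoord_symm_apply]; rfl

@[simp] lemma coord_chart (t : Fin d → ℝ) : T.coord i (T.chart i t) = t := by
  rw [chart_eq, coord]; simp

@[simp] lemma chart_coord (x : E d) : T.chart i (T.coord i x) = x := by
  rw [chart_eq, coord]; simp

lemma elem_eq : T.elem i = T.chart i '' Set.Icc 0 1 := rfl

lemma mem_elem {x : E d} : x ∈ T.elem i ↔ T.coord i x ∈ Set.Icc (0 : Fin d → ℝ) 1 := by
  rw [elem_eq]
  constructor
  · rintro ⟨t, ht, rfl⟩; simpa using ht
  · intro h; exact ⟨_, h, chart_coord x⟩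

lemma chart_mem_elem {t : Fin d → ℝ} (ht : t ∈ Set.Icc (0 : Fin d → ℝ) 1) :
    T.chart i t ∈ T.elem i := ⟨t, ht, rfl⟩

lemma coord_sub (x y : E d) : T.coord i x - T.coord i y = T.linCoord i (x - y) := by
  simp only [coord]; rw [← map_sub]; congr 1; abel

lemma coord_add_smul (x z : E d) (s : ℝ) :
    T.coord i (x + s • z) = T.coord i x + s • T.linCoord i z := by
  simp only [coord]; rw [← map_smul, ← map_add]; congr 1; abel

lemma contDiff_coord : ContDiff ℝ 1 (T.coord i) :=
  (T.linCoord i).contDiff.comp (contDiff_id.sub contDiff_const)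

lemma continuous_coord : Continuous (T.coord i) := contDiff_coord.continuous

lemma continuous_chart : Continuous (T.chart i) := by
  rw [show T.chart i = fun t => T.base i + (T.linCoord i).symm t from funext chart_eq]
  fun_prop

variable (T) in
/-- The affine coordinates as a homeomorphism. -/
def coordHomeo (i : Fin T.card) : E d ≃ₜ (Fin d → ℝ) where
  toFun := T.coord i
  invFun := T.chart i
  left_inv := chart_coord
  right_inv := coord_chart
  continuous_toFun := continuous_coord
  continuous_invFun := continuous_chart

lemma elem_eq_preimage : T.elem i = T.coordHomeo i ⁻¹' Set.Icc 0 1 := by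
  ext x; exact mem_elem

lemma isCompact_elem : IsCompact (T.elem i) := isCompact_Icc.image continuous_chart

lemma isClosed_elem : IsClosed (T.elem i) := isCompact_elem.isClosed

lemma convex_elem : Convex ℝ (T.elem i) := by
  intro x hx y hy a b ha hb hab
  rw [mem_elem] at *
  have h : T.coord i (a • x + b • y) = a • T.coord i x + b • T.coord i y := by
    simp only [coord]; rw [← map_smul, ← map_smul, ← map_add]
    congr 1
    have : T.base i = a • T.base i + b • T.base i := by rw [← add_smul, hab, one_smul]
    nth_rw 1 [this]
    module
  rw [h]
  exact convex_Icc _ _ hx hy ha hb hab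

lemma elem_subset_closure_interior : T.elem i ⊆ closure (interior (T.elem i)) := by
  rw [elem_eq_preimage, ← Homeomorph.preimage_interior, ← Homeomorph.preimage_closure]
  exact Set.preimage_mono cube_subset_closure_interior

lemma volume_frontier_elem : volume (frontier (T.elem i)) = 0 :=
  convex_elem.addHaar_frontier _

/-- An element is the closure of its interior, so an open set that meets it also meets its interior.
-/
lemma disjoint_interior_elem (h : i ≠ j) : Disjoint (interior (T.elem i)) (T.elem j) := by
  rw [Set.disjoint_iff_inter_eq_empty]
  by_contra hne
  obtain ⟨x, hx, hxj⟩ := Set.nonempty_iff_ne_empty.2 hne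
  obtain ⟨y, hy, hyj⟩ := mem_closure_iff.1 (elem_subset_closure_interior hxj) _ isOpen_interior hx
  exact Set.disjoint_left.1 (T.disjoint_interior i j h) hy hyj

lemma interior_elem_ae : (interior (T.elem i) : Set (E d)) =ᵐ[volume] T.elem i :=
  interior_ae_eq_of_null_frontier volume_frontier_elem

lemma aedisjoint_elem (h : i ≠ j) : AEDisjoint volume (T.elem i) (T.elem j) := by
  refine (Disjoint.aedisjoint (disjoint_interior_elem h)).congr
    interior_elem_ae.symm (Filter.EventuallyEq.refl _ _)

lemma mem_unionOf {s : Set (Fin T.card)} {x : E d} : x ∈ T.unionOf s ↔ ∃ i ∈ s, x ∈ T.elem i := by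
  simp [unionOf]

lemma elem_subset_unionOf {s : Set (Fin T.card)} (h : i ∈ s) : T.elem i ⊆ T.unionOf s :=
  fun _ hx => mem_unionOf.2 ⟨i, h, hx⟩

lemma isClosed_unionOf (s : Set (Fin T.card)) : IsClosed (T.unionOf s) :=
  (Set.toFinite s).isClosed_biUnion fun _ _ => isClosed_elem

lemma closure_interior_unionOf (s : Set (Fin T.card)) :
    closure (interior (T.unionOf s)) = T.unionOf s := by
  apply (closure_minimal interior_subset (isClosed_unionOf s)).antisymm
  intro x hx
  obtain ⟨i, hi, hxi⟩ := mem_unionOf.1 hx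
  exact closure_mono (interior_mono (elem_subset_unionOf hi)) (elem_subset_closure_interior hxi)

/-- What the interior misses lies on the frontiers of finitely many convex sets, which are null.
Integrals over Ω can therefore be split into integrals over the elements. -/
lemma interior_unionOf_ae (s : Set (Fin T.card)) :
    (interior (T.unionOf s) : Set (E d)) =ᵐ[volume] T.unionOf s := by
  have hsub : T.unionOf s \ interior (T.unionOf s) ⊆ ⋃ i, frontier (T.elem i) := by
    rintro x ⟨hx, hxi⟩
    obtain ⟨i, hi, hx'⟩ := mem_unionOf.1 hx
    refine Set.mem_iUnion.2 ⟨i, subset_closure hx', fun h => hxi ?_⟩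
    exact interior_mono (elem_subset_unionOf hi) h
  have h0 : volume (T.unionOf s \ interior (T.unionOf s)) = 0 :=
    measure_mono_null hsub (measure_iUnion_null fun i => volume_frontier_elem)
  exact (Filter.EventuallyLE.antisymm
    (Filter.Eventually.of_forall interior_subset) (ae_le_set.2 h0))

lemma ae_elem_of_ae_domain {p : E d → Prop} (h : ∀ᵐ x ∂(volume.restrict T.domain), p x)
    (i : Fin T.card) : ∀ᵐ x ∂(volume.restrict (T.elem i)), p x := by
  unfold domain at h
  rw [Measure.restrict_congr_set (interior_unionOf_ae Set.univ)] at h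
  exact ae_restrict_of_ae_restrict_of_subset (elem_subset_unionOf (Set.mem_univ i)) h

lemma restrict_elem_le (i : Fin T.card) :
    volume.restrict (T.elem i) ≤ volume.restrict T.domain := by
  unfold domain
  rw [Measure.restrict_congr_set (interior_unionOf_ae Set.univ)]
  exact Measure.restrict_mono (elem_subset_unionOf (Set.mem_univ i)) le_rfl

/-- Integrals over the domain split into integrals over the elements. -/
lemma integral_domain {g : E d → ℝ} (hg : ∀ i, IntegrableOn g (T.elem i)) :
    ∫ x in T.domain, g x = ∑ i, ∫ x in T.elem i, g x := by
  unfold domain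
  rw [setIntegral_congr_set (interior_unionOf_ae Set.univ)]
  have hU : T.unionOf Set.univ = ⋃ i, T.elem i := by simp [unionOf]
  rw [hU, integral_iUnion_ae (fun i => isClosed_elem.measurableSet.nullMeasurableSet)
    (fun i j h => aedisjoint_elem h) (integrableOn_finite_iUnion.2 hg), tsum_fintype]

/-- An affine coordinate stays in [0, 1] on a ball of radius r, which bounds its slope. The test
points c ± s z lie at distance r/2 from the centre, inside the open ball. -/
lemma abs_coord_sub_le {c : E d} {r : ℝ} (hr : 0 < r) (h : Metric.ball c r ⊆ T.elem i)
    (x y : E d) (k : Fin d) : |T.coord i x k - T.coord i y k| ≤ ‖x - y‖ / r := by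
  have key : ∀ z : E d, |T.linCoord i z k| ≤ ‖z‖ / r := by
    intro z
    rcases eq_or_ne z 0 with rfl | hz
    · simp
    have hzn : 0 < ‖z‖ := norm_pos_iff.2 hz
    set s := r / (2 * ‖z‖) with hs
    have hs0 : 0 < s := by positivity
    have hmem : ∀ e : ℝ, |e| = 1 → c + (e * s) • z ∈ T.elem i := by
      intro e he
      apply h
      rw [mem_ball_iff_norm, add_sub_cancel_left, norm_smul, Real.norm_eq_abs, abs_mul, he, one_mul,
        abs_of_pos hs0, hs]
      field_simp
      linarith
    have h1 := mem_elem.1 (hmem 1 (by simp))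
    have h2 := mem_elem.1 (hmem (-1) (by simp))
    rw [coord_add_smul] at h1 h2
    have a1 := h1.1 k
    have a2 := h1.2 k
    have a3 := h2.1 k
    have a4 := h2.2 k
    simp only [Pi.zero_apply, Pi.one_apply, Pi.add_apply, Pi.smul_apply, smul_eq_mul] at a1 a2 a3 a4
    have hb : |2 * s * T.linCoord i z k| ≤ 1 := by rw [abs_le]; constructor <;> linarith
    rw [abs_mul, abs_of_pos (by positivity)] at hb
    rw [le_div_iff₀ hr]
    have e : 2 * s = r / ‖z‖ := by rw [hs]; field_simp
    rw [e, div_mul_eq_mul_div, div_le_one hzn] at hb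
    linarith
  have := key (x - y)
  rwa [← coord_sub] at this

/-- Change of variables to the reference cube, up to a positive factor. -/
lemma exists_integral_elem (i : Fin T.card) : ∃ c : ℝ, 0 < c ∧ volume.real (T.elem i) = c ∧
    ∀ g : (Fin d → ℝ) → ℝ, ∫ x in T.elem i, g (T.coord i x) =
      c * ∫ t in Set.Icc (0 : Fin d → ℝ) 1, g t := by
  set L := T.linCoord i
  have hL : (Measure.map L (volume : Measure (E d))).IsAddHaarMeasure :=
    L.isAddHaarMeasure_map volume
  set c := Measure.addHaarScalarFactor (Measure.map L (volume : Measure (E d))) volume with hc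
  have hmap : Measure.map L (volume : Measure (E d)) = c • volume :=
    Measure.isAddLeftInvariant_eq_smul _ _
  have hmap' : Measure.map (T.coord i) (volume : Measure (E d)) = c • volume := by
    rw [← hmap]
    have e : T.coord i = L ∘ (fun x => x + (-T.base i)) := by
      funext x; simp [coord, L, sub_eq_add_neg]
    rw [e, ← Measure.map_map L.continuous.measurable (measurable_add_const _),
      map_add_right_eq_self]
  have hcpos : 0 < c := Measure.addHaarScalarFactor_pos_of_isAddHaarMeasure _ _
  have hmeas : MeasurableEmbedding (T.coord i) := (T.coordHomeo i).measurableEmbedding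
  have hpre : T.coord i ⁻¹' Set.Icc 0 1 = T.elem i := by ext x; exact mem_elem.symm
  have hint : ∀ g : (Fin d → ℝ) → ℝ, ∫ x in T.elem i, g (T.coord i x) =
      (c : ℝ) * ∫ t in Set.Icc (0 : Fin d → ℝ) 1, g t := by
    intro g
    have := hmeas.setIntegral_map (μ := volume) g (Set.Icc (0 : Fin d → ℝ) 1)
    rw [hpre, hmap', Measure.restrict_smul, integral_smul_nnreal_measure] at this
    rw [← this]; rfl
  refine ⟨c, by exact_mod_cast hcpos, ?_, hint⟩
  have h1 := hint fun _ => 1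
  simp only [integral_const, MeasurableSet.univ, measureReal_restrict_apply, Set.univ_inter,
    smul_eq_mul, mul_one] at h1
  rw [h1]
  have : volume.real (Set.Icc (0 : Fin d → ℝ) 1) = 1 := by
    simp [Measure.real, Real.volume_Icc_pi]
  rw [this, mul_one]

end Mesh

/-! ### Faces of the cube and signed permutation matrices. -/

section Transition

variable {d : ℕ}

open Classical in
/-- The nearest point of a face of the unit cube. -/
def faceProj (I₀ I₁ : Set (Fin d)) (s : Fin d → ℝ) : Fin d → ℝ :=
  fun k => if k ∈ I₀ then 0 else if k ∈ I₁ then 1 else s k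

lemma faceProj_mem {I₀ I₁ : Set (Fin d)} (hne : (cubeFace I₀ I₁).Nonempty) {s : Fin d → ℝ}
    (hs : s ∈ Set.Icc (0 : Fin d → ℝ) 1) : faceProj I₀ I₁ s ∈ cubeFace I₀ I₁ := by
  obtain ⟨t, -, ht0, ht1⟩ := hne
  have hdis : ∀ k ∈ I₁, k ∉ I₀ := fun k h1 h0 => by
    have := (ht0 k h0).symm.trans (ht1 k h1); norm_num at this
  refine ⟨⟨fun k => ?_, fun k => ?_⟩, fun k hk => by simp [faceProj, hk],
    fun k hk => by simp [faceProj, hk, hdis k hk]⟩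
  · have := hs.1 k
    simp only [faceProj, Pi.zero_apply] at *
    split_ifs <;> linarith
  · have := hs.2 k
    simp only [faceProj, Pi.one_apply] at *
    split_ifs <;> linarith

lemma faceProj_eq_self {I₀ I₁ : Set (Fin d)} {s : Fin d → ℝ} (hs : s ∈ cubeFace I₀ I₁) :
    faceProj I₀ I₁ s = s := by
  funext k
  simp only [faceProj]
  split_ifs with h0 h1
  · exact (hs.2.1 k h0).symm
  · exact (hs.2.2 k h1).symm
  · rfl

lemma faceProj_update_of_mem {I₀ I₁ : Set (Fin d)} (s : Fin d → ℝ) {k : Fin d}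
    (hk : k ∈ I₀ ∪ I₁) (r : ℝ) : faceProj I₀ I₁ (Function.update s k r) = faceProj I₀ I₁ s := by
  funext j
  by_cases hj : j = k
  · subst hj
    simp only [faceProj]
    split_ifs with h0 h1
    · rfl
    · rfl
    · exact absurd hk (by simp [h0, h1])
  · simp [faceProj, hj]

lemma faceProj_update_of_notMem {I₀ I₁ : Set (Fin d)} (s : Fin d → ℝ) {k : Fin d}
    (hk : k ∉ I₀ ∪ I₁) (r : ℝ) :
    faceProj I₀ I₁ (Function.update s k r) = Function.update (faceProj I₀ I₁ s) k r := by
  have hk' : k ∉ I₀ ∧ k ∉ I₁ := by simpa using hk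
  funext j
  by_cases hj : j = k
  · subst hj; simp [faceProj, hk'.1, hk'.2]
  · simp [faceProj, hj]

lemma faceProj_corner (I₀ I₁ : Set (Fin d)) (σ : Fin d → Bool) :
    ∃ τ, faceProj I₀ I₁ (corner σ) = corner τ := by
  classical
  refine ⟨fun k => if k ∈ I₀ then false else if k ∈ I₁ then true else σ k, ?_⟩
  funext k
  simp only [faceProj, corner]
  split_ifs <;> simp_all

/-- Composition with a map that moves at most one coordinate, affinely, when one coordinate of the
argument moves. -/
lemma SepAffine.comp {f : (Fin d → ℝ) → ℝ} (hf : SepAffine f) (ζ : (Fin d → ℝ) → (Fin d → ℝ))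
    (hζ : ∀ s k, ∃ p c ε, ∀ r : ℝ, ζ (Function.update s k r) =
      Function.update (ζ s) p (c + r * ε)) : SepAffine (fun s => f (ζ s)) := by
  intro s k r
  obtain ⟨p, c, ε, h⟩ := hζ s k
  simp only [h]
  rw [hf (ζ s) p (c + r * ε), hf (ζ s) p (c + 0 * ε), hf (ζ s) p (c + 1 * ε)]
  ring

/-- Two mutually inverse matrices whose absolute column sums are at most one are signed
permutation matrices. -/
lemma signed_permutation {ι : Type*} (M N : ι → ι → ℝ) (P Q : Finset ι)
    (hMN : ∀ p ∈ P, ∑ q ∈ Q, M p q * N q p = 1) (hNM : ∀ q ∈ Q, ∑ p ∈ P, N q p * M p q = 1)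
    (hM : ∀ q ∈ Q, ∑ p ∈ P, |M p q| ≤ 1) (hN : ∀ p ∈ P, ∑ q ∈ Q, |N q p| ≤ 1) :
    (∀ q ∈ Q, ∀ p ∈ P, ∀ p' ∈ P, N q p ≠ 0 → N q p' ≠ 0 → p = p') ∧
      ∀ p ∈ P, ∃ q ∈ Q, |N q p| = 1 := by
  -- Equality case: 1 = ∑ M N ≤ ∑ |M| |N| ≤ ∑ |N| ≤ 1 forces |M| = 1 wherever N does not vanish. Two
  -- such entries of M in one column would exceed the column bound.
  have key : ∀ (M N : ι → ι → ℝ) (P Q : Finset ι), (∀ p ∈ P, ∑ q ∈ Q, M p q * N q p = 1) →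
      (∀ q ∈ Q, ∑ p ∈ P, |M p q| ≤ 1) → (∀ p ∈ P, ∑ q ∈ Q, |N q p| ≤ 1) →
      ∀ p ∈ P, ∀ q ∈ Q, N q p ≠ 0 → |M p q| = 1 := by
    intro M N P Q hMN hM hN p hp q hq hne
    have hle : ∀ q ∈ Q, |M p q| ≤ 1 := fun q hq =>
      (Finset.single_le_sum (f := fun p => |M p q|) (fun _ _ => abs_nonneg _) hp).trans (hM q hq)
    by_contra hlt
    have hlt' : |M p q| < 1 := lt_of_le_of_ne (hle q hq) hlt
    have h1 : ∑ q ∈ Q, M p q * N q p < ∑ q ∈ Q, |N q p| := by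
      have hpt : ∀ q ∈ Q, M p q * N q p ≤ |N q p| := fun q hq => by
        refine (le_abs_self _).trans ?_
        rw [abs_mul]
        exact mul_le_of_le_one_left (abs_nonneg _) (hle q hq)
      refine Finset.sum_lt_sum hpt ⟨q, hq, ?_⟩
      refine (le_abs_self _).trans_lt ?_
      rw [abs_mul]
      exact mul_lt_of_lt_one_left (abs_pos.2 hne) hlt'
    linarith [hMN p hp, hN p hp]
  have k1 := key M N P Q hMN hM hN
  have k2 := key N M Q P hNM hN hM
  refine ⟨fun q hq p hp p' hp' h h' => ?_, fun p hp => ?_⟩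
  · by_contra hpp
    have h2 : |M p q| + |M p' q| ≤ ∑ p ∈ P, |M p q| := by
      classical
      rw [← Finset.sum_pair (f := fun p => |M p q|) hpp]
      refine Finset.sum_le_sum_of_subset_of_nonneg ?_ fun _ _ _ => abs_nonneg _
      intro x hx
      rcases Finset.mem_insert.1 hx with rfl | hx
      · exact hp
      · rw [Finset.mem_singleton.1 hx]; exact hp'
    linarith [hM q hq, k1 p hp q hq h, k1 p' hp' q hq h']
  · by_contra hne
    push Not at hne
    have h0 : ∀ q ∈ Q, M p q * N q p = 0 := by
      intro q hq
      by_cases hN0 : N q p = 0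
      · rw [hN0, mul_zero]
      · have h1 := k1 p hp q hq hN0
        have h2 := k2 q hq p hp (by intro h; rw [h] at h1; simp at h1)
        exact absurd h2 (hne q hq)
    have := hMN p hp
    rw [Finset.sum_eq_zero h0] at this
    norm_num at this

end Transition

/-! ### Conformity: coordinate changes along common faces and points interior to the domain. -/

namespace Mesh

variable {d : ℕ} {T : Mesh d} {i j : Fin T.card}

lemma coord_chart_sub (t s : Fin d → ℝ) :
    T.coord j (T.chart i t) - T.coord j (T.chart i s) =
      ∑ k, (t k - s k) • T.linCoord j (T.edge i k) := by
  rw [coord_sub, chart_eq, chart_eq, add_sub_add_left_eq_sub, ← map_sub, linCoord_symm_apply,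
    map_sum]
  simp only [map_smul, Pi.sub_apply]

lemma linCoord_edge (k : Fin d) : T.linCoord i (T.edge i k) = Pi.single k 1 := by
  rw [← ContinuousLinearEquiv.eq_symm_apply, linCoord_symm_apply,
    Finset.sum_eq_single k (fun l _ h => by simp [h]) (by simp)]
  simp

lemma transition_mul (p p' : Fin d) :
    ∑ q, T.linCoord j (T.edge i p) q * T.linCoord i (T.edge j q) p' =
      (Pi.single p 1 : Fin d → ℝ) p' := by
  rw [← linCoord_edge (i := i) p]
  have h : T.edge i p = ∑ q, T.linCoord j (T.edge i p) q • T.edge j q := by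
    rw [← linCoord_symm_apply]; simp
  conv_rhs => rw [h]
  rw [map_sum, Finset.sum_apply]
  simp

section Face

variable {I₀ I₁ J₀ J₁ : Set (Fin d)}

lemma coord_chart_mem (h : T.chart i '' cubeFace I₀ I₁ ⊆ T.chart j '' cubeFace J₀ J₁)
    {t : Fin d → ℝ} (ht : t ∈ cubeFace I₀ I₁) : T.coord j (T.chart i t) ∈ cubeFace J₀ J₁ := by
  obtain ⟨s, hs, e⟩ := h ⟨t, ht, rfl⟩
  rw [← e, coord_chart]; exact hs

/-- A move along a free edge of the face stays in the face, where the q-th coordinate of the other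
element is constant. -/
lemma transition_eq_zero (h : T.chart i '' cubeFace I₀ I₁ ⊆ T.chart j '' cubeFace J₀ J₁)
    (hne : (cubeFace I₀ I₁).Nonempty) {p q : Fin d} (hp : p ∉ I₀ ∪ I₁) (hq : q ∈ J₀ ∪ J₁) :
    T.linCoord j (T.edge i p) q = 0 := by
  have h0 : (0 : Fin d → ℝ) ∈ Set.Icc (0 : Fin d → ℝ) 1 := ⟨le_rfl, zero_le_one⟩
  have h1 : Function.update (0 : Fin d → ℝ) p 1 ∈ Set.Icc (0 : Fin d → ℝ) 1 := by
    constructor <;> intro k <;> by_cases hk : k = p <;> simp [hk]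
  have e0 := coord_chart_mem h (faceProj_mem hne h0)
  have e1 := coord_chart_mem h (faceProj_mem hne h1)
  rw [faceProj_update_of_notMem _ hp] at e1
  have hs := congrFun (coord_chart_sub (T := T) (i := i) (j := j)
    (Function.update (faceProj I₀ I₁ 0) p 1) (faceProj I₀ I₁ 0)) q
  have hp' : p ∉ I₀ ∧ p ∉ I₁ := by simpa using hp
  rw [Finset.sum_eq_single p (fun l _ hl => by simp [hl]) (by simp)] at hs
  have hf : faceProj I₀ I₁ (0 : Fin d → ℝ) p = 0 := by simp [faceProj, hp'.1, hp'.2]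
  simp only [Pi.sub_apply, Function.update_self, hf, sub_zero, one_smul] at hs
  rw [← hs]
  rcases hq with hq | hq
  · rw [e1.2.1 q hq, e0.2.1 q hq, sub_self]
  · rw [e1.2.2 q hq, e0.2.2 q hq, sub_self]

open Classical in
-- The left side is the oscillation of one coordinate of element j over the face, attained between
-- the two opposite vertices picked by the signs of the entries; this coordinate stays in [0, 1].
lemma sum_abs_transition_le (h : T.chart i '' cubeFace I₀ I₁ ⊆ T.chart j '' cubeFace J₀ J₁)
    (hne : (cubeFace I₀ I₁).Nonempty) (q : Fin d) :
    ∑ p ∈ Finset.univ.filter (fun p => p ∉ I₀ ∪ I₁), |T.linCoord j (T.edge i p) q| ≤ 1 := by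
  set M : Fin d → ℝ := fun p => T.linCoord j (T.edge i p) q
  set s : Fin d → ℝ := fun p => if 0 < M p then 1 else 0
  set t : Fin d → ℝ := fun p => if 0 < M p then 0 else 1
  have hs : s ∈ Set.Icc (0 : Fin d → ℝ) 1 := by
    constructor <;> intro k <;> simp only [s] <;> split_ifs <;> simp
  have ht : t ∈ Set.Icc (0 : Fin d → ℝ) 1 := by
    constructor <;> intro k <;> simp only [t] <;> split_ifs <;> simp
  have e0 := (coord_chart_mem h (faceProj_mem hne hs)).1.2 q
  have e1 := (coord_chart_mem h (faceProj_mem hne ht)).1.1 q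
  have hd := congrFun (coord_chart_sub (T := T) (i := i) (j := j)
    (faceProj I₀ I₁ s) (faceProj I₀ I₁ t)) q
  rw [Finset.sum_apply] at hd
  have hsum : ∑ p ∈ Finset.univ.filter (fun p => p ∉ I₀ ∪ I₁), |M p| =
      ∑ p, ((faceProj I₀ I₁ s p - faceProj I₀ I₁ t p) • T.linCoord j (T.edge i p)) q := by
    rw [Finset.sum_filter]
    refine Finset.sum_congr rfl fun p _ => ?_
    simp only [Pi.smul_apply, smul_eq_mul]
    change (if p ∉ I₀ ∪ I₁ then |M p| else 0) = _ * M p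
    by_cases h0 : p ∈ I₀
    · simp [faceProj, h0]
    · by_cases h1 : p ∈ I₁
      · simp [faceProj, h1]
      · simp only [Set.mem_union, h0, h1, or_self, not_false_eq_true, if_true, faceProj, if_false,
          s, t]
        by_cases hM : 0 < M p
        · simp [hM, abs_of_pos hM]
        · simp [hM, abs_of_nonpos (not_lt.1 hM)]
  change ∑ p ∈ Finset.univ.filter (fun p => p ∉ I₀ ∪ I₁), |M p| ≤ 1
  rw [hsum, ← hd]
  simp only [Pi.zero_apply, Pi.one_apply, Pi.sub_apply] at *
  linarith

/-- Along a common face of two elements the edge directions agree up to order and orientation. -/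
lemma transition_signed_permutation
    (h : T.chart i '' cubeFace I₀ I₁ = T.chart j '' cubeFace J₀ J₁)
    (hne : (cubeFace I₀ I₁).Nonempty) :
    (∀ q ∉ J₀ ∪ J₁, ∀ p p', T.linCoord i (T.edge j q) p ≠ 0 →
      T.linCoord i (T.edge j q) p' ≠ 0 → p = p') ∧
    ∀ p ∉ I₀ ∪ I₁, ∃ q ∉ J₀ ∪ J₁, |T.linCoord i (T.edge j q) p| = 1 := by
  classical
  have hne' : (cubeFace J₀ J₁).Nonempty := by
    have := hne.image (T.chart i)
    rw [h] at this
    exact this.of_image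
  have restrict : ∀ (i j : Fin T.card) (I₀ I₁ J₀ J₁ : Set (Fin d)),
      T.chart i '' cubeFace I₀ I₁ ⊆ T.chart j '' cubeFace J₀ J₁ → (cubeFace I₀ I₁).Nonempty →
      ∀ p ∈ Finset.univ.filter (fun p => p ∉ I₀ ∪ I₁),
      ∑ q ∈ Finset.univ.filter (fun q => q ∉ J₀ ∪ J₁),
        T.linCoord j (T.edge i p) q * T.linCoord i (T.edge j q) p = 1 := by
    intro i j I₀ I₁ J₀ J₁ h hne p hp
    have hp' : p ∉ I₀ ∪ I₁ := (Finset.mem_filter.1 hp).2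
    have e := transition_mul (T := T) (i := i) (j := j) p p
    rw [Pi.single_eq_same] at e
    rw [← e]
    refine Finset.sum_subset (Finset.filter_subset _ _) fun q _ hq => ?_
    have hq' : q ∈ J₀ ∪ J₁ := by
      by_contra hc
      exact hq (Finset.mem_filter.2 ⟨Finset.mem_univ _, hc⟩)
    rw [transition_eq_zero h hne hp' hq', zero_mul]
  have main := signed_permutation (fun p q => T.linCoord j (T.edge i p) q)
    (fun q p => T.linCoord i (T.edge j q) p)
    (Finset.univ.filter (fun p => p ∉ I₀ ∪ I₁)) (Finset.univ.filter (fun q => q ∉ J₀ ∪ J₁))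
    (restrict i j I₀ I₁ J₀ J₁ h.subset hne) (restrict j i J₀ J₁ I₀ I₁ h.symm.subset hne')
    (fun q _ => sum_abs_transition_le h.subset hne q)
    (fun p _ => sum_abs_transition_le h.symm.subset hne' p)
  refine ⟨fun q hq p p' hp hp' => ?_, fun p hp => ?_⟩
  · have hP : ∀ p, T.linCoord i (T.edge j q) p ≠ 0 →
        p ∈ Finset.univ.filter (fun p => p ∉ I₀ ∪ I₁) := by
      intro p hp
      refine Finset.mem_filter.2 ⟨Finset.mem_univ _, fun hc => hp ?_⟩
      exact transition_eq_zero h.symm.subset hne' hq hc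
    exact main.1 q (Finset.mem_filter.2 ⟨Finset.mem_univ _, hq⟩) p (hP p hp) p' (hP p' hp') hp hp'
  · obtain ⟨q, hq, hq1⟩ := main.2 p (Finset.mem_filter.2 ⟨Finset.mem_univ _, hp⟩)
    exact ⟨q, (Finset.mem_filter.1 hq).2, hq1⟩

lemma coord_chart_update (s : Fin d → ℝ) (q : Fin d) (r : ℝ) :
    T.coord i (T.chart j (Function.update s q r)) =
      T.coord i (T.chart j s) + (r - s q) • T.linCoord i (T.edge j q) := by
  rw [← sub_eq_iff_eq_add', coord_chart_sub,
    Finset.sum_eq_single q (fun l _ h => by simp [h]) (by simp)]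
  simp

/-- A coordinate of element i either is fixed to 0 or 1 on the face, or changes by ±1 along some
free edge of element j. In the latter case both ends of that edge have coordinate in [0, 1], so the
coordinate is 0 at one end and 1 at the other. -/
lemma coord_vertex (h : T.chart i '' cubeFace I₀ I₁ = T.chart j '' cubeFace J₀ J₁)
    (hne : (cubeFace I₀ I₁).Nonempty) {σ : Fin d → Bool} (hσ : corner σ ∈ cubeFace J₀ J₁) :
    ∃ τ, T.coord i (T.chart j (corner σ)) = corner τ := by
  have hmem := coord_chart_mem h.symm.subset hσ
  suffices hs : ∀ p, T.coord i (T.chart j (corner σ)) p = 0 ∨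
      T.coord i (T.chart j (corner σ)) p = 1 by
    refine ⟨fun p => decide (T.coord i (T.chart j (corner σ)) p = 1), ?_⟩
    funext p
    rcases hs p with h0 | h0 <;> simp [corner, h0]
  intro p
  by_cases hp : p ∈ I₀ ∪ I₁
  · rcases hp with hp | hp
    · exact Or.inl (hmem.2.1 p hp)
    · exact Or.inr (hmem.2.2 p hp)
  obtain ⟨q, hq, hq1⟩ := (transition_signed_permutation h hne).2 p hp
  have hq' : q ∉ J₀ ∧ q ∉ J₁ := by simpa using hq
  have hup : ∀ r : ℝ, 0 ≤ r → r ≤ 1 → Function.update (corner σ) q r ∈ cubeFace J₀ J₁ := by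
    intro r h0 h1
    refine ⟨⟨fun k => ?_, fun k => ?_⟩, fun k hk => ?_, fun k hk => ?_⟩
    · by_cases hk : k = q
      · subst hk; simpa using h0
      · simpa [hk] using hσ.1.1 k
    · by_cases hk : k = q
      · subst hk; simpa using h1
      · simpa [hk] using hσ.1.2 k
    · rw [Function.update_of_ne (by rintro rfl; exact hq'.1 hk)]; exact hσ.2.1 k hk
    · rw [Function.update_of_ne (by rintro rfl; exact hq'.2 hk)]; exact hσ.2.2 k hk
  have m0 := (coord_chart_mem h.symm.subset (hup 0 le_rfl zero_le_one)).1
  have m1 := (coord_chart_mem h.symm.subset (hup 1 zero_le_one le_rfl)).1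
  rw [coord_chart_update] at m0 m1
  have a0 := m0.1 p
  have a1 := m0.2 p
  have b0 := m1.1 p
  have b1 := m1.2 p
  simp only [Pi.zero_apply, Pi.one_apply, Pi.add_apply, Pi.smul_apply, smul_eq_mul] at a0 a1 b0 b1
  rcases (abs_eq zero_le_one).1 hq1 with e | e <;> rw [e] at a0 a1 b0 b1 <;>
    cases hσq : σ q <;> simp only [corner, hσq] at a0 a1 b0 b1 ⊢ <;> norm_num at a0 a1 b0 b1 ⊢
  · left; linarith
  · right; linarith
  · right; linarith
  · left; linarith

end Face

/-- `Q₁` interpolation of the same nodal values on two elements agrees on their intersection. -/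
lemma qint_compat (N : E d → ℝ) {x : E d} (hi : x ∈ T.elem i) (hj : x ∈ T.elem j) :
    qint (fun σ => N (T.chart i (corner σ))) (T.coord i x) =
      qint (fun σ => N (T.chart j (corner σ))) (T.coord j x) := by
  rcases eq_or_ne i j with rfl | hij
  · rfl
  obtain ⟨I₀, I₁, J₀, J₁, hI, hJ⟩ := T.face_to_face i j hij ⟨x, hi, hj⟩
  change T.elem i ∩ T.elem j = T.chart i '' cubeFace I₀ I₁ at hI
  change T.elem i ∩ T.elem j = T.chart j '' cubeFace J₀ J₁ at hJ
  have h : T.chart i '' cubeFace I₀ I₁ = T.chart j '' cubeFace J₀ J₁ := hI.symm.trans hJ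
  have hxi : x ∈ T.chart i '' cubeFace I₀ I₁ := hI ▸ ⟨hi, hj⟩
  have hne : (cubeFace I₀ I₁).Nonempty := ⟨_, hxi.choose_spec.1⟩
  obtain ⟨s, hs, rfl⟩ : x ∈ T.chart j '' cubeFace J₀ J₁ := hJ ▸ ⟨hi, hj⟩
  have hne' : (cubeFace J₀ J₁).Nonempty := ⟨s, hs⟩
  -- Precomposition with the projection onto the face extends both interpolants from the face to
  -- functions affine in each coordinate of the whole cube, so it suffices to compare them at the
  -- corners.
  set ζ : (Fin d → ℝ) → (Fin d → ℝ) := fun s => T.coord i (T.chart j (faceProj J₀ J₁ s)) with hζ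
  have haff1 : SepAffine fun s => qint (fun σ => N (T.chart i (corner σ))) (ζ s) := by
    refine (sepAffine_qint _).comp ζ fun s q => ?_
    by_cases hq : q ∈ J₀ ∪ J₁
    · refine ⟨q, ζ s q, 0, fun r => ?_⟩
      simp only [hζ, faceProj_update_of_mem s hq, mul_zero, add_zero, Function.update_eq_self]
    · have hsup := (transition_signed_permutation h hne).1 q hq
      obtain ⟨p, hp⟩ : ∃ p, ∀ p', p' ≠ p → T.linCoord i (T.edge j q) p' = 0 := by
        by_cases hz : ∃ p, T.linCoord i (T.edge j q) p ≠ 0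
        · obtain ⟨p, hp⟩ := hz
          refine ⟨p, fun p' hne => ?_⟩
          by_contra hc
          exact hne (hsup p' p hc hp)
        · push Not at hz
          exact ⟨q, fun p' _ => hz p'⟩
      refine ⟨p, ζ s p - faceProj J₀ J₁ s q * T.linCoord i (T.edge j q) p,
        T.linCoord i (T.edge j q) p, fun r => ?_⟩
      simp only [hζ, faceProj_update_of_notMem s hq, coord_chart_update]
      funext p'
      by_cases hpp : p' = p
      · subst hpp; simp; ring
      · simp [hpp, hp p' hpp]
  have haff2 : SepAffine fun s => qint (fun σ => N (T.chart j (corner σ))) (faceProj J₀ J₁ s) := by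
    refine (sepAffine_qint _).comp _ fun s q => ?_
    by_cases hq : q ∈ J₀ ∪ J₁
    · refine ⟨q, faceProj J₀ J₁ s q, 0, fun r => ?_⟩
      rw [faceProj_update_of_mem s hq, mul_zero, add_zero, Function.update_eq_self]
    · refine ⟨q, 0, 1, fun r => ?_⟩
      rw [faceProj_update_of_notMem s hq, mul_one, zero_add]
  -- A corner projects to a vertex of the common face, which is a vertex of both elements; both
  -- interpolants take the same nodal value there.
  have hzero := (haff1.sub haff2).eq_zero (fun σ => by
    obtain ⟨σ', hσ'⟩ := faceProj_corner J₀ J₁ σ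
    have hm : corner σ' ∈ cubeFace J₀ J₁ := hσ' ▸ faceProj_mem hne' (corner_mem σ)
    obtain ⟨τ, hτ⟩ := coord_vertex h hne hm
    simp only [hζ, hσ']
    rw [qint_corner, hτ, qint_corner, ← hτ, chart_coord, sub_self]) s
  simp only [hζ, faceProj_eq_self hs] at hzero
  rw [coord_chart]
  linarith

/-- If a point of a face of an element is interior to the domain, then so is every point in the
relative interior of that face. -/
lemma mem_domain_of_face {x y : E d} (hx : x ∈ T.elem i) (hy : y ∈ T.elem i)
    (h0 : ∀ k, T.coord i x k = 0 → T.coord i y k = 0)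
    (h1 : ∀ k, T.coord i x k = 1 → T.coord i y k = 1) (hyΩ : y ∈ T.domain) : x ∈ T.domain := by
  have hxc := mem_elem.1 hx
  have hyc := mem_elem.1 hy
  have hopen : IsOpen T.domain := isOpen_interior
  obtain ⟨ε, hε0, hε1, hεΩ⟩ : ∃ ε : ℝ, 0 < ε ∧ ε < 1 ∧ y + ε • (x - y) ∈ T.domain := by
    have hc : Filter.Tendsto (fun ε : ℝ => y + ε • (x - y)) (nhdsWithin 0 (Set.Ioi 0)) (nhds y) := by
      have : Continuous fun ε : ℝ => y + ε • (x - y) := by fun_prop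
      have := this.tendsto 0
      simp only [zero_smul, add_zero] at this
      exact this.mono_left nhdsWithin_le_nhds
    obtain ⟨ε, hε, hε'⟩ := ((hc.eventually (hopen.mem_nhds hyΩ)).and
      (Ioo_mem_nhdsGT (zero_lt_one' ℝ))).exists
    exact ⟨ε, hε'.1, hε'.2, hε⟩
  obtain ⟨η, hη0, hη⟩ : ∃ η : ℝ, 0 < η ∧
      ∀ k, 0 ≤ T.coord i x k + η * (T.coord i x k - T.coord i y k) ∧
        T.coord i x k + η * (T.coord i x k - T.coord i y k) ≤ 1 := by
    have hev : ∀ᶠ η in nhdsWithin (0 : ℝ) (Set.Ioi 0),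
        ∀ k, 0 ≤ T.coord i x k + η * (T.coord i x k - T.coord i y k) ∧
          T.coord i x k + η * (T.coord i x k - T.coord i y k) ≤ 1 := by
      refine Filter.eventually_all.2 fun k => ?_
      have hx0 := hxc.1 k
      have hx1 := hxc.2 k
      simp only [Pi.zero_apply, Pi.one_apply] at hx0 hx1
      rcases hx0.eq_or_lt with e | hx0
      · refine Filter.Eventually.of_forall fun η => ?_
        rw [h0 k e.symm, ← e]; simp
      rcases hx1.eq_or_lt with e | hx1
      · refine Filter.Eventually.of_forall fun η => ?_
        rw [h1 k e, e]; simp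
      have hc : Filter.Tendsto (fun η : ℝ => T.coord i x k + η * (T.coord i x k - T.coord i y k))
          (nhdsWithin 0 (Set.Ioi 0)) (nhds (T.coord i x k)) := by
        have : Continuous fun η : ℝ =>
          T.coord i x k + η * (T.coord i x k - T.coord i y k) := by fun_prop
        have := this.tendsto 0
        simp only [zero_mul, add_zero] at this
        exact this.mono_left nhdsWithin_le_nhds
      filter_upwards [hc.eventually (Ioo_mem_nhds hx0 hx1)] with η hη
      exact ⟨hη.1.le, hη.2.le⟩
    obtain ⟨η, hη, hη'⟩ := (hev.and self_mem_nhdsWithin).exists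
    exact ⟨η, hη', hη⟩
  -- On the line through y and x, the point x' is close to y and still in Ω, while y' lies slightly
  -- beyond x and still in element i; x is strictly between them.
  set x' := y + ε • (x - y) with hx'
  set y' := x + η • (x - y) with hy'
  have cx' : ∀ k, T.coord i x' k = (1 - ε) * T.coord i y k + ε * T.coord i x k := by
    intro k
    rw [hx', coord_add_smul, ← coord_sub]
    simp only [Pi.add_apply, Pi.smul_apply, Pi.sub_apply, smul_eq_mul]; ring
  have cy' : ∀ k, T.coord i y' k =
      T.coord i x k + η * (T.coord i x k - T.coord i y k) := by
    intro k
    rw [hy', coord_add_smul, ← coord_sub]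
    simp only [Pi.add_apply, Pi.smul_apply, Pi.sub_apply, smul_eq_mul]
  have hy'i : y' ∈ T.elem i :=
    mem_elem.2 ⟨fun k => by rw [cy']; exact (hη k).1, fun k => by rw [cy']; exact (hη k).2⟩
  have hx'i : x' ∈ T.elem i := by
    have := (convex_elem (T := T) (i := i)) hy hx (by linarith : 0 ≤ 1 - ε) hε0.le (by ring)
    convert this using 1
    rw [hx']; module
  -- The common face with element j contains x', a strict mixture of x and y. Each 0/1 constraint of
  -- the face then holds at x, hence at y by hypothesis, hence at y'.
  have hall : ∀ j, x' ∈ T.elem j → y' ∈ T.elem j := by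
    intro j hj
    rcases eq_or_ne i j with rfl | hij
    · exact hy'i
    obtain ⟨I₀, I₁, J₀, J₁, hI, -⟩ := T.face_to_face i j hij ⟨x', hx'i, hj⟩
    change T.elem i ∩ T.elem j = T.chart i '' cubeFace I₀ I₁ at hI
    obtain ⟨s, hs, hsx⟩ : x' ∈ T.chart i '' cubeFace I₀ I₁ := hI ▸ ⟨hx'i, hj⟩
    have hsc : s = T.coord i x' := by rw [← hsx, coord_chart]
    subst hsc
    have hy'F : y' ∈ T.chart i '' cubeFace I₀ I₁ := by
      refine ⟨T.coord i y', ⟨mem_elem.1 hy'i, fun k hk => ?_, fun k hk => ?_⟩, chart_coord _⟩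
      · have e := hs.2.1 k hk
        rw [cx'] at e
        have a := hxc.1 k
        have b := hyc.1 k
        simp only [Pi.zero_apply] at a b
        have : T.coord i x k = 0 := by
          have := mul_nonneg (by linarith : 0 ≤ 1 - ε) b
          have h2 : ε * T.coord i x k = 0 := le_antisymm (by linarith) (mul_nonneg hε0.le a)
          exact (mul_eq_zero.1 h2).resolve_left hε0.ne'
        rw [cy', h0 k this, this]; simp
      · have e := hs.2.2 k hk
        rw [cx'] at e
        have a := hxc.2 k
        have b := hyc.2 k
        simp only [Pi.one_apply] at a b
        have : T.coord i x k = 1 := by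
          have := mul_nonneg (by linarith : 0 ≤ 1 - ε) (sub_nonneg.2 b)
          have h2 : ε * (1 - T.coord i x k) = 0 :=
            le_antisymm (by linarith) (mul_nonneg hε0.le (sub_nonneg.2 a))
          have := (mul_eq_zero.1 h2).resolve_left hε0.ne'
          linarith
        rw [cy', h1 k this, this]; simp
    exact (hI.symm ▸ hy'F : y' ∈ T.elem i ∩ T.elem j).2
  -- The weight for which x = w x' + (1 - w) y'.
  set w := η / (1 - ε + η) with hw
  have hden : 0 < 1 - ε + η := by linarith
  have hw0 : 0 < w := div_pos hη0 hden
  have hw1 : w ≤ 1 := (div_le_one hden).2 (by linarith)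
  -- Near x', only elements containing x' occur. The homothety with centre y' and ratio w carries
  -- such a neighbourhood onto one of x, and by convexity it keeps each of these elements, all of
  -- which contain y', inside itself.
  set U : Set (E d) := T.domain ∩ (T.unionOf {j | x' ∉ T.elem j})ᶜ with hU
  have hUo : IsOpen U := hopen.inter (isClosed_unionOf _).isOpen_compl
  have hx'U : x' ∈ U := ⟨hεΩ, fun hc => by
    obtain ⟨j, hj, hxj⟩ := mem_unionOf.1 hc
    exact hj hxj⟩
  set ψ : E d → E d := fun p => x' + w⁻¹ • (p - x) with hψ
  have hψc : Continuous ψ := by fun_prop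
  have hψx : ψ x = x' := by simp [hψ]
  refine interior_maximal (s := T.unionOf Set.univ) (t := ψ ⁻¹' U) ?_ (hUo.preimage hψc)
    (show ψ x ∈ U from hψx ▸ hx'U)
  intro p hp
  obtain ⟨j, -, hpj⟩ := mem_unionOf.1 (interior_subset hp.1)
  have hj : x' ∈ T.elem j := by
    by_contra hc
    exact hp.2 (mem_unionOf.2 ⟨j, hc, hpj⟩)
  refine mem_unionOf.2 ⟨j, Set.mem_univ j, ?_⟩
  have hconv := (convex_elem (T := T) (i := j)) hpj (hall j hj) hw0.le
    (by linarith : 0 ≤ 1 - w) (by ring)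
  convert hconv using 1
  have hbal : w * (1 - ε) = (1 - w) * η := by rw [hw]; field_simp; ring
  have e1 : w • ψ p = w • x' + (p - x) := by
    rw [hψ, smul_add, smul_smul, mul_inv_cancel₀ hw0.ne', one_smul]
  have e2 : w • x' + (1 - w) • y' = x + ((1 - w) * η - w * (1 - ε)) • (x - y) := by
    rw [hx', hy']; module
  rw [e1]
  have e3 : w • x' + (p - x) + (1 - w) • y' = (w • x' + (1 - w) • y') + (p - x) := by abel
  rw [e3, e2, hbal, sub_self, zero_smul]; abel

end Mesh

/-! ### The cut-off operator on the finite element space, and layers of elements. -/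

namespace Mesh

variable {d : ℕ} {T : Mesh d} {i j : Fin T.card}

/-- The position of a vertex of an element. -/
def vertex (T : Mesh d) (i : Fin T.card) (σ : Fin d → Bool) : E d := T.chart i (corner σ)

lemma vertex_mem_elem (σ : Fin d → Bool) : T.vertex i σ ∈ T.elem i :=
  chart_mem_elem (corner_mem σ)

/-- Finite element functions are determined on each element by their vertex values. -/
lemma apply_eq_qint {v : E d → ℝ} (hv : v ∈ T.Vh) {x : E d} (hx : x ∈ T.elem i) :
    v x = qint (fun σ => v (T.vertex i σ)) (T.coord i x) := by
  obtain ⟨p, hp, hvp⟩ := hv.2.2 i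
  have e : ∀ t ∈ Set.Icc (0 : Fin d → ℝ) 1, v (T.chart i t) = MvPolynomial.eval t p := hvp
  have h1 := e _ (mem_elem.1 hx)
  rw [chart_coord] at h1
  rw [h1, (sepAffine_eval p hp).eq_qint (T.coord i x)]
  congr 1
  funext σ
  exact (e _ (corner_mem σ)).symm

lemma mem_Vh_iff {v : E d → ℝ} : v ∈ T.Vh ↔ Continuous v ∧ (∀ x, x ∉ T.domain → v x = 0) ∧
    ∀ i, ∀ x ∈ T.elem i, v x = qint (fun σ => v (T.vertex i σ)) (T.coord i x) := by
  refine ⟨fun hv => ⟨hv.1, hv.2.1, fun i x hx => apply_eq_qint hv hx⟩,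
    fun hv => ⟨hv.1, hv.2.1, fun i => ?_⟩⟩
  obtain ⟨p, hp, hpe⟩ := exists_poly_qint (fun σ => v (T.vertex i σ))
  refine ⟨p, hp, fun t ht => ?_⟩
  have := hv.2.2 i _ (chart_mem_elem ht)
  rw [coord_chart, hpe] at this
  exact this

variable (T) in
/-- The finite element space as a vector space. -/
def VhSub : Submodule ℝ (E d → ℝ) where
  carrier := T.Vh
  add_mem' {v w} hv hw := by
    rw [mem_Vh_iff] at *
    refine ⟨hv.1.add hw.1, fun x hx => by simp [hv.2.1 x hx, hw.2.1 x hx], fun i x hx => ?_⟩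
    have := qint_add (fun σ => v (T.vertex i σ)) (fun σ => w (T.vertex i σ)) (T.coord i x)
    rw [Pi.add_apply, hv.2.2 i x hx, hw.2.2 i x hx, ← this]
    rfl
  zero_mem' := by
    rw [mem_Vh_iff]
    exact ⟨continuous_const, fun x _ => rfl, fun i x _ => by simp [qint]⟩
  smul_mem' c v hv := by
    rw [mem_Vh_iff] at *
    refine ⟨hv.1.const_smul c, fun x hx => by simp [hv.2.1 x hx], fun i x hx => ?_⟩
    have := qint_smul c (fun σ => v (T.vertex i σ)) (T.coord i x)
    rw [Pi.smul_apply, hv.2.2 i x hx, smul_eq_mul, ← this]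
    rfl

open Classical in
/-- The nodal values of `w`, set to zero on the closed union of the elements in `s`. -/
def nodal (T : Mesh d) (s : Set (Fin T.card)) (w : E d → ℝ) (x : E d) : ℝ :=
  if x ∈ T.unionOf s then 0 else w x

open Classical in
/-- The nodal interpolant of the function that is zero on the elements in `s` and `w` elsewhere. -/
def cut (T : Mesh d) (s : Set (Fin T.card)) (w : E d → ℝ) (x : E d) : ℝ :=
  if h : ∃ i, x ∈ T.elem i then
    qint (fun σ => T.nodal s w (T.vertex h.choose σ)) (T.coord h.choose x) else 0

variable {s : Set (Fin T.card)} {w : E d → ℝ}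

lemma cut_apply {x : E d} (hx : x ∈ T.elem i) :
    T.cut s w x = qint (fun σ => T.nodal s w (T.vertex i σ)) (T.coord i x) := by
  have h : ∃ i, x ∈ T.elem i := ⟨i, hx⟩
  rw [cut, dif_pos h]
  exact qint_compat (T.nodal s w) h.choose_spec hx

lemma cut_vertex (σ : Fin d → Bool) : T.cut s w (T.vertex i σ) = T.nodal s w (T.vertex i σ) := by
  rw [cut_apply (vertex_mem_elem σ)]
  conv_lhs => rw [vertex, coord_chart, qint_corner]

lemma abs_cut_vertex_le (σ : Fin d → Bool) :
    |T.cut s w (T.vertex i σ)| ≤ |w (T.vertex i σ)| := by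
  rw [cut_vertex, nodal]
  split_ifs <;> simp

lemma cut_eq_zero (hi : i ∈ s) {x : E d} (hx : x ∈ T.elem i) : T.cut s w x = 0 := by
  rw [cut_apply hx]
  have : ∀ σ, T.nodal s w (T.vertex i σ) = 0 := fun σ =>
    if_pos (elem_subset_unionOf hi (vertex_mem_elem σ))
  simp [this, qint]

lemma cut_eq_self (hw : w ∈ T.Vh) (hi : ¬ (T.unionOf s ∩ T.elem i).Nonempty) {x : E d}
    (hx : x ∈ T.elem i) : T.cut s w x = w x := by
  rw [cut_apply hx, apply_eq_qint hw hx]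
  congr 1
  funext σ
  exact if_neg fun h => hi ⟨_, h, vertex_mem_elem σ⟩

lemma mem_elem_of_mem_domain {x : E d} (hx : x ∈ T.domain) : ∃ i, x ∈ T.elem i := by
  obtain ⟨i, -, h⟩ := mem_unionOf.1 (interior_subset hx)
  exact ⟨i, h⟩

lemma shape_eq_zero_of_coord {σ : Fin d → Bool} {t : Fin d → ℝ} {k : Fin d}
    (h : (t k = 0 ∧ σ k = true) ∨ (t k = 1 ∧ σ k = false)) : shape σ t = 0 := by
  refine Finset.prod_eq_zero (Finset.mem_univ k) ?_
  rcases h with ⟨h1, h2⟩ | ⟨h1, h2⟩ <;> simp [h1, h2]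

/-- The shape functions that do not vanish at x belong to vertices of the smallest face containing
x. None of these vertices is in Ω, as otherwise x would be, so w vanishes there. -/
lemma cut_eq_zero_of_notMem_domain (hw : w ∈ T.Vh) {x : E d} (hx : x ∉ T.domain) :
    T.cut s w x = 0 := by
  by_cases h : ∃ i, x ∈ T.elem i
  · obtain ⟨i, hi⟩ := h
    rw [cut_apply hi]
    refine Finset.sum_eq_zero fun σ _ => ?_
    by_cases hσ : ∃ k, (T.coord i x k = 0 ∧ σ k = true) ∨ (T.coord i x k = 1 ∧ σ k = false)
    · obtain ⟨k, hk⟩ := hσ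
      rw [shape_eq_zero_of_coord hk, mul_zero]
    · push Not at hσ
      have hy : T.vertex i σ ∉ T.domain := fun hy => by
        refine hx (mem_domain_of_face hi (vertex_mem_elem σ) (fun k hk => ?_) (fun k hk => ?_) hy)
        · have := (hσ k).1 hk
          simp [vertex, corner, this]
        · have := (hσ k).2 hk
          simp only [ne_eq, Bool.not_eq_false] at this
          simp [vertex, corner, this]
      have : T.nodal s w (T.vertex i σ) = 0 := by
        rw [nodal, hw.2.1 _ hy, ite_self]
      simp only
      rw [this, zero_mul]
  · rw [cut, dif_neg h]

lemma cut_mem (hw : w ∈ T.Vh) : T.cut s w ∈ T.Vh := by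
  rw [mem_Vh_iff]
  refine ⟨?_, fun x hx => cut_eq_zero_of_notMem_domain hw hx, fun i x hx => ?_⟩
  · have hfin : LocallyFinite fun o : Option (Fin T.card) =>
        o.elim T.domainᶜ (fun i => T.elem i) := locallyFinite_of_finite _
    refine hfin.continuous ?_ ?_ ?_
    · refine Set.eq_univ_of_forall fun x => Set.mem_iUnion.2 ?_
      by_cases hx : x ∈ T.domain
      · obtain ⟨i, hi⟩ := mem_elem_of_mem_domain hx
        exact ⟨some i, hi⟩
      · exact ⟨none, hx⟩
    · rintro (_ | i)
      · exact isOpen_interior.isClosed_compl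
      · exact isClosed_elem
    · rintro (_ | i)
      · exact continuousOn_const.congr (f := fun _ => (0 : ℝ))
          fun x hx => cut_eq_zero_of_notMem_domain hw hx
      · exact (((contDiff_qint _).continuous.comp continuous_coord).continuousOn).congr
          fun x hx => cut_apply hx
  · rw [cut_apply hx]
    simp only [cut_vertex]

variable (T) in
/-- The cut-off operator on the finite element space. -/
def cutLin (s : Set (Fin T.card)) : T.VhSub →ₗ[ℝ] T.VhSub where
  toFun w := ⟨T.cut s w, cut_mem w.2⟩
  map_add' v w := by
    ext x
    change T.cut s (v + w : E d → ℝ) x = T.cut s v x + T.cut s w x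
    by_cases h : ∃ i, x ∈ T.elem i
    · obtain ⟨i, hi⟩ := h
      rw [cut_apply hi, cut_apply hi, cut_apply hi, ← qint_add]
      congr 1
      funext σ
      simp only [nodal, Pi.add_apply]
      split_ifs <;> simp
    · simp only [cut, dif_neg h, add_zero]
  map_smul' c v := by
    ext x
    change T.cut s (c • v : E d → ℝ) x = c * T.cut s v x
    by_cases h : ∃ i, x ∈ T.elem i
    · obtain ⟨i, hi⟩ := h
      rw [cut_apply hi, cut_apply hi, ← qint_smul]
      congr 1
      funext σ
      simp only [nodal, Pi.smul_apply]
      split_ifs <;> simp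
    · simp only [cut, dif_neg h, mul_zero]

/-- The element layers around a set of elements: `layer s (k + 1)` consists of the elements that
meet an element of `layer s k`. -/
def layer (T : Mesh d) (s : Set (Fin T.card)) : ℕ → Set (Fin T.card)
  | 0 => s
  | k + 1 => {i | (T.unionOf (T.layer s k) ∩ T.elem i).Nonempty}

lemma elem_nonempty : (T.elem i).Nonempty := ⟨_, vertex_mem_elem fun _ => false⟩

lemma layer_mono (s : Set (Fin T.card)) : Monotone (T.layer s) := by
  refine monotone_nat_of_le_succ fun k i hi => ?_
  obtain ⟨x, hx⟩ := elem_nonempty (T := T) (i := i)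
  exact ⟨x, elem_subset_unionOf hi hx, hx⟩

/-- Passing to interiors loses nothing: the closure of the interior of a union of elements is the
union again, so patches and combinatorial layers grow in step. -/
lemma patch_eq (s : Set (Fin T.card)) (l : ℕ) :
    T.patch (T.unionOf s) (l + 1) = interior (T.unionOf (T.layer s (l + 1))) := by
  induction l with
  | zero =>
    change T.nbhd (T.unionOf s) = _
    rw [nbhd, (isClosed_unionOf s).closure_eq]
    rfl
  | succ l ih =>
    change T.nbhd (T.patch (T.unionOf s) (l + 1)) = _
    rw [nbhd, ih, closure_interior_unionOf]
    rfl

/-- A finite element function supported in a union of elements vanishes on the other elements. -/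
lemma eq_zero_of_support_subset {v : E d → ℝ} (hv : Continuous v)
    (h : Function.support v ⊆ T.unionOf s) (hi : i ∉ s) {x : E d} (hx : x ∈ T.elem i) :
    v x = 0 := by
  have h0 : interior (T.elem i) ⊆ {x | v x = 0} := by
    intro y hy
    by_contra hne
    obtain ⟨j, hj, hyj⟩ := mem_unionOf.1 (h hne)
    have hij : i ≠ j := by rintro rfl; exact hi hj
    exact Set.disjoint_left.1 (disjoint_interior_elem hij) hy hyj
  have hcl : IsClosed {x | v x = 0} := isClosed_eq hv continuous_const
  exact closure_minimal h0 hcl (elem_subset_closure_interior hx)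

/-- The support of a continuous function is open, so lying in the closed union it lies in the
interior. -/
lemma support_subset_interior {v : E d → ℝ} (hv : v ∈ T.Vh)
    (h : ∀ i ∉ s, ∀ x ∈ T.elem i, v x = 0) : Function.support v ⊆ interior (T.unionOf s) := by
  refine interior_maximal ?_ hv.1.isOpen_support
  intro x hx
  have hxΩ : x ∈ T.domain := by
    by_contra hc; exact hx (hv.2.1 x hc)
  obtain ⟨i, hi⟩ := mem_elem_of_mem_domain hxΩ
  refine mem_unionOf.2 ⟨i, ?_, hi⟩
  by_contra hc
  exact hx (h i hc x hi)

end Mesh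

/-! ### Pointwise gradients. -/

section Gradient

variable {d : ℕ}

lemma measurable_gradient (v : E d → ℝ) : Measurable (gradient v) :=
  (InnerProductSpace.toDual ℝ (E d)).symm.continuous.measurable.comp (measurable_fderiv ℝ v)

lemma norm_gradient (v : E d → ℝ) (x : E d) : ‖gradient v x‖ = ‖fderiv ℝ v x‖ :=
  (InnerProductSpace.toDual ℝ (E d)).symm.norm_map _

lemma gradient_add {v w : E d → ℝ} {x : E d} (hv : DifferentiableAt ℝ v x)
    (hw : DifferentiableAt ℝ w x) : gradient (v + w) x = gradient v x + gradient w x := by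
  simp only [gradient]
  rw [fderiv_add hv hw, map_add]

lemma gradient_smul {v : E d → ℝ} {x : E d} (hv : DifferentiableAt ℝ v x) (c : ℝ) :
    gradient (c • v) x = c • gradient v x := by
  simp only [gradient]
  rw [fderiv_const_smul hv c, map_smul]

lemma gradient_congr {v w : E d → ℝ} {x : E d} (h : v =ᶠ[nhds x] w) :
    gradient v x = gradient w x := by
  simp only [gradient, h.fderiv_eq]

end Gradient

/-! ### Element forms, norm comparison and the inverse estimate. -/

namespace Mesh

variable {d : ℕ} {T : Mesh d} {i : Fin T.card}

lemma eventuallyEq_of_eqOn_elem {v w : E d → ℝ} (h : Set.EqOn v w (T.elem i)) {x : E d}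
    (hx : x ∈ interior (T.elem i)) : v =ᶠ[nhds x] w :=
  Filter.eventuallyEq_of_mem (mem_interior_iff_mem_nhds.1 hx) h

lemma differentiableAt_of_mem_Vh {v : E d → ℝ} (hv : v ∈ T.Vh) {x : E d}
    (hx : x ∈ interior (T.elem i)) : DifferentiableAt ℝ v x := by
  have h : Set.EqOn v (fun x => qint (fun σ => v (T.vertex i σ)) (T.coord i x)) (T.elem i) :=
    fun x hx => apply_eq_qint hv hx
  refine DifferentiableAt.congr_of_eventuallyEq ?_ (eventuallyEq_of_eqOn_elem h hx)
  exact ((contDiff_qint _).comp contDiff_coord).differentiable one_ne_zero x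

/-- The local Lipschitz constant of the Q₁ representation: each of the d affine coordinates is
1/r-Lipschitz, and each shape function has slope at most one in each coordinate. -/
lemma norm_gradient_le {r : ℝ} (hr : 0 < r) (hball : ∃ c, Metric.ball c r ⊆ T.elem i)
    {v : E d → ℝ} (hv : v ∈ T.Vh) {x : E d} (hx : x ∈ interior (T.elem i)) :
    ‖gradient v x‖ ≤ d / r * ∑ σ, |v (T.vertex i σ)| := by
  obtain ⟨c, hc⟩ := hball
  rw [norm_gradient]
  refine norm_fderiv_le_of_lip' ℝ (by positivity) ?_
  filter_upwards [mem_interior_iff_mem_nhds.1 hx] with y hy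
  have hx' := interior_subset hx
  rw [Real.norm_eq_abs, apply_eq_qint hv hy, apply_eq_qint hv hx']
  refine (abs_qint_sub_le _ (mem_elem.1 hy) (mem_elem.1 hx')).trans ?_
  have h : ∑ k, |T.coord i y k - T.coord i x k| ≤ ∑ _k : Fin d, ‖y - x‖ / r :=
    Finset.sum_le_sum fun k _ => abs_coord_sub_le hr hc y x k
  rw [Finset.sum_const, Finset.card_univ, Fintype.card_fin, nsmul_eq_mul] at h
  calc _ ≤ (∑ σ, |v (T.vertex i σ)|) * (d * (‖y - x‖ / r)) :=
        mul_le_mul_of_nonneg_left h (Finset.sum_nonneg fun _ _ => abs_nonneg _)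
    _ = _ := by ring

lemma abs_apply_le_sum {v : E d → ℝ} (hv : v ∈ T.Vh) {x : E d} (hx : x ∈ T.elem i) :
    |v x| ≤ ∑ σ, |v (T.vertex i σ)| := by
  rw [apply_eq_qint hv hx]
  exact abs_qint_le _ (mem_elem.1 hx)

lemma ae_mem_interior (i : Fin T.card) :
    ∀ᵐ x ∂(volume.restrict (T.elem i)), x ∈ interior (T.elem i) := by
  rw [← Measure.restrict_congr_set interior_elem_ae]
  exact ae_restrict_mem isOpen_interior.measurableSet

lemma volume_elem_lt_top : volume (T.elem i) < ⊤ := isCompact_elem.measure_lt_top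

instance : IsFiniteMeasure (volume.restrict (T.elem i)) :=
  isFiniteMeasure_restrict.2 volume_elem_lt_top.ne

lemma integrableOn_mul {v w : E d → ℝ} (hv : Continuous v) (hw : Continuous w) (i : Fin T.card) :
    IntegrableOn (fun x => v x * w x) (T.elem i) :=
  (hv.mul hw).continuousOn.integrableOn_compact isCompact_elem

/-- A measurable coefficient with essential bounds `α ≤ A ≤ β`. -/
structure IsCoeff (T : Mesh d) (A : E d → ℝ) (α β : ℝ) : Prop where
  pos : 0 < α
  meas : AEMeasurable A (volume.restrict T.domain)
  bounds : ∀ᵐ x ∂(volume.restrict T.domain), α ≤ A x ∧ A x ≤ β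

variable {A : E d → ℝ} {α β r : ℝ}

lemma integrableOn_energy (hA : T.IsCoeff A α β) (hr : 0 < r)
    (hball : ∃ c, Metric.ball c r ⊆ T.elem i) {v w : E d → ℝ} (hv : v ∈ T.Vh) (hw : w ∈ T.Vh) :
    IntegrableOn (fun x => A x * inner ℝ (gradient v x) (gradient w x)) (T.elem i) := by
  set Cv := d / r * ∑ σ, |v (T.vertex i σ)|
  set Cw := d / r * ∑ σ, |w (T.vertex i σ)|
  refine Integrable.of_bound (C := β * (Cv * Cw)) ?_ ?_
  · refine AEMeasurable.aestronglyMeasurable ?_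
    exact (hA.meas.mono_measure (restrict_elem_le i)).mul
      ((measurable_gradient v).inner (measurable_gradient w)).aemeasurable
  · filter_upwards [ae_elem_of_ae_domain hA.bounds i, ae_mem_interior i] with x hx hxi
    have h1 := norm_gradient_le hr hball hv hxi
    have h2 := norm_gradient_le hr hball hw hxi
    rw [norm_mul, Real.norm_eq_abs, abs_of_pos (hA.pos.trans_le hx.1)]
    have h3 := norm_inner_le_norm (𝕜 := ℝ) (gradient v x) (gradient w x)
    have hpos := hA.pos.trans_le hx.1
    exact mul_le_mul hx.2 (h3.trans (mul_le_mul h1 h2 (norm_nonneg _) ((norm_nonneg _).trans h1)))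
      (norm_nonneg _) (hpos.le.trans hx.2)

variable (T) in
/-- The `L²` form of an element. -/
def massForm (i : Fin T.card) : BilinForm ℝ T.VhSub :=
  LinearMap.mk₂ ℝ (fun v w => l2 (T.elem i) v w)
    (fun v v' w => by
      simp only [l2]
      rw [← integral_add (integrableOn_mul v.2.1 w.2.1 i) (integrableOn_mul v'.2.1 w.2.1 i)]
      refine integral_congr_ae (Filter.Eventually.of_forall fun x => ?_)
      exact add_mul _ _ _)
    (fun c v w => by
      simp only [l2, smul_eq_mul]
      rw [← integral_const_mul]
      refine integral_congr_ae (Filter.Eventually.of_forall fun x => ?_)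
      exact mul_assoc _ _ _)
    (fun v w w' => by
      simp only [l2]
      rw [← integral_add (integrableOn_mul v.2.1 w.2.1 i) (integrableOn_mul v.2.1 w'.2.1 i)]
      refine integral_congr_ae (Filter.Eventually.of_forall fun x => ?_)
      exact mul_add _ _ _)
    (fun c v w => by
      simp only [l2, smul_eq_mul]
      rw [← integral_const_mul]
      refine integral_congr_ae (Filter.Eventually.of_forall fun x => ?_)
      exact mul_left_comm _ _ _)

lemma aForm_symm (S : Set (E d)) (v w : E d → ℝ) : aForm A S v w = aForm A S w v := by
  simp only [aForm, real_inner_comm]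

lemma aForm_elem_add (hA : T.IsCoeff A α β) (hr : 0 < r)
    (hball : ∃ c, Metric.ball c r ⊆ T.elem i) {v v' w : E d → ℝ} (hv : v ∈ T.Vh)
    (hv' : v' ∈ T.Vh) (hw : w ∈ T.Vh) : aForm A (T.elem i) (v + v') w =
      aForm A (T.elem i) v w + aForm A (T.elem i) v' w := by
  simp only [aForm]
  rw [← integral_add (integrableOn_energy hA hr hball hv hw)
    (integrableOn_energy hA hr hball hv' hw)]
  refine integral_congr_ae ?_
  filter_upwards [ae_mem_interior i] with x hx
  rw [gradient_add (differentiableAt_of_mem_Vh hv hx) (differentiableAt_of_mem_Vh hv' hx),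
    inner_add_left, mul_add]

lemma aForm_elem_smul (c : ℝ) {v : E d → ℝ} (hv : v ∈ T.Vh) (w : E d → ℝ) :
    aForm A (T.elem i) (c • v) w = c * aForm A (T.elem i) v w := by
  simp only [aForm]
  rw [← integral_const_mul]
  refine integral_congr_ae ?_
  filter_upwards [ae_mem_interior i] with x hx
  rw [gradient_smul (differentiableAt_of_mem_Vh hv hx), inner_smul_left]
  simp only [conj_trivial]
  ring

/-- The scaled energy form `(τ² / 4) a(v, w)` of an element. -/
def energyForm (hA : T.IsCoeff A α β) (hr : 0 < r) (τ : ℝ) (i : Fin T.card)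
    (hball : ∃ c, Metric.ball c r ⊆ T.elem i) : BilinForm ℝ T.VhSub :=
  LinearMap.mk₂ ℝ (fun v w => τ ^ 2 / 4 * aForm A (T.elem i) v w)
    (fun v v' w => by
      rw [Submodule.coe_add, aForm_elem_add hA hr hball v.2 v'.2 w.2, mul_add])
    (fun c v w => by
      rw [Submodule.coe_smul, aForm_elem_smul c v.2, smul_eq_mul]; ring)
    (fun v w w' => by
      rw [Submodule.coe_add, aForm_symm, aForm_elem_add hA hr hball w.2 w'.2 v.2, mul_add,
        aForm_symm, aForm_symm _ (w' : E d → ℝ)])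
    (fun c v w => by
      rw [Submodule.coe_smul, aForm_symm, aForm_elem_smul c w.2, aForm_symm, smul_eq_mul]; ring)

lemma massForm_apply (v w : T.VhSub) : T.massForm i v w = l2 (T.elem i) v w := rfl

lemma energyForm_apply (hA : T.IsCoeff A α β) (hr : 0 < r) (τ : ℝ)
    (hball : ∃ c, Metric.ball c r ⊆ T.elem i) (v w : T.VhSub) :
    energyForm hA hr τ i hball v w = τ ^ 2 / 4 * aForm A (T.elem i) v w := rfl

lemma massForm_psd : (T.massForm i).IsPosSemidef := by
  refine LinearMap.BilinForm.isPosSemidef_def.2 ⟨⟨fun v w => ?_⟩, ⟨fun v => ?_⟩⟩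
  · simp only [massForm_apply, l2, mul_comm]
  · exact integral_nonneg fun x => mul_self_nonneg _

lemma energyForm_psd (hA : T.IsCoeff A α β) (hr : 0 < r) (τ : ℝ)
    (hball : ∃ c, Metric.ball c r ⊆ T.elem i) : (energyForm hA hr τ i hball).IsPosSemidef := by
  refine LinearMap.BilinForm.isPosSemidef_def.2 ⟨⟨fun v w => ?_⟩, ⟨fun v => ?_⟩⟩
  · rw [energyForm_apply, energyForm_apply, aForm_symm]
  · rw [energyForm_apply]
    refine mul_nonneg (by positivity) (integral_nonneg_of_ae ?_)
    filter_upwards [ae_elem_of_ae_domain hA.bounds i] with x hx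
    exact mul_nonneg (hA.pos.le.trans hx.1) real_inner_self_nonneg

lemma l2_elem_congr {v v' : E d → ℝ} (w : E d → ℝ) (h : Set.EqOn v v' (T.elem i)) :
    l2 (T.elem i) w v = l2 (T.elem i) w v' :=
  setIntegral_congr_fun isClosed_elem.measurableSet fun x hx => by simp only [h hx]

lemma aForm_elem_congr {v v' : E d → ℝ} (w : E d → ℝ) (h : Set.EqOn v v' (T.elem i)) :
    aForm A (T.elem i) w v = aForm A (T.elem i) w v' := by
  refine integral_congr_ae ?_
  filter_upwards [ae_mem_interior i] with x hx
  rw [gradient_congr (eventuallyEq_of_eqOn_elem h hx)]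

lemma sq_sum_abs_le (a : (Fin d → Bool) → ℝ) : (∑ σ, |a σ|) ^ 2 ≤ 2 ^ d * ∑ σ, a σ ^ 2 := by
  have := sq_sum_le_card_mul_sum_sq (s := Finset.univ) (f := fun σ => |a σ|)
  simpa using this

/-- The vertex values of a finite element function are controlled by its `L²` norm. -/
lemma volume_mul_sq_sum_le {c : ℝ} (hc : ∀ a : (Fin d → Bool) → ℝ,
      ∑ σ, a σ ^ 2 ≤ c * ∫ t in Set.Icc (0 : Fin d → ℝ) 1, qint a t ^ 2)
    {w : E d → ℝ} (hw : w ∈ T.Vh) (i : Fin T.card) :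
    volume.real (T.elem i) * (∑ σ, |w (T.vertex i σ)|) ^ 2 ≤
      2 ^ d * c * l2 (T.elem i) w w := by
  obtain ⟨V, hV, hvol, hint⟩ := T.exists_integral_elem i
  have e : l2 (T.elem i) w w = V * ∫ t in Set.Icc (0 : Fin d → ℝ) 1,
      qint (fun σ => w (T.vertex i σ)) t ^ 2 := by
    rw [← hint]
    refine setIntegral_congr_fun isClosed_elem.measurableSet fun x hx => ?_
    rw [apply_eq_qint hw hx, sq]
  rw [hvol, e]
  have h1 := (sq_sum_abs_le fun σ => w (T.vertex i σ)).trans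
    (mul_le_mul_of_nonneg_left (hc fun σ => w (T.vertex i σ)) (by positivity))
  calc _ ≤ V * _ := mul_le_mul_of_nonneg_left h1 hV.le
    _ = _ := by ring

lemma sum_abs_mono {v w : E d → ℝ} (h : ∀ σ, |v (T.vertex i σ)| ≤ |w (T.vertex i σ)|) :
    (∑ σ, |v (T.vertex i σ)|) ^ 2 ≤ (∑ σ, |w (T.vertex i σ)|) ^ 2 :=
  pow_le_pow_left₀ (Finset.sum_nonneg fun _ _ => abs_nonneg _)
    (Finset.sum_le_sum fun σ _ => h σ) 2

lemma l2_elem_le {v : E d → ℝ} (hv : v ∈ T.Vh) :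
    l2 (T.elem i) v v ≤ volume.real (T.elem i) * (∑ σ, |v (T.vertex i σ)|) ^ 2 := by
  have h : l2 (T.elem i) v v ≤ ∫ _x in T.elem i, (∑ σ, |v (T.vertex i σ)|) ^ 2 := by
    refine setIntegral_mono_on (integrableOn_mul hv.1 hv.1 i) (integrable_const _)
      isClosed_elem.measurableSet fun x hx => ?_
    rw [← sq, ← sq_abs]
    exact pow_le_pow_left₀ (abs_nonneg _) (abs_apply_le_sum hv hx) 2
  simpa using h

/-- Inverse estimate. -/
lemma aForm_elem_le (hA : T.IsCoeff A α β) (hr : 0 < r)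
    (hball : ∃ c, Metric.ball c r ⊆ T.elem i) {v : E d → ℝ} (hv : v ∈ T.Vh) :
    aForm A (T.elem i) v v ≤
      β * (d / r) ^ 2 * (volume.real (T.elem i) * (∑ σ, |v (T.vertex i σ)|) ^ 2) := by
  have h : aForm A (T.elem i) v v ≤
      ∫ _x in T.elem i, β * (d / r * ∑ σ, |v (T.vertex i σ)|) ^ 2 := by
    refine integral_mono_ae (integrableOn_energy hA hr hball hv hv) (integrable_const _) ?_
    filter_upwards [ae_elem_of_ae_domain hA.bounds i, ae_mem_interior i] with x hx hxi
    rw [real_inner_self_eq_norm_sq]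
    have hpos := hA.pos.trans_le hx.1
    exact mul_le_mul hx.2 (pow_le_pow_left₀ (norm_nonneg _) (norm_gradient_le hr hball hv hxi) 2)
      (sq_nonneg _) (hpos.le.trans hx.2)
  refine h.trans (le_of_eq ?_)
  rw [setIntegral_const, smul_eq_mul]
  ring

end Mesh

/-! ### The finite element cut-off system and its relation to the forms on the domain. -/

namespace Mesh

variable {d : ℕ} {T : Mesh d} {A : E d → ℝ} {α β r τ c : ℝ}

/-- The cut-off system of the finite element space, with the layers around a set of elements. -/
def cutSystem (hA : T.IsCoeff A α β) (hβ : 0 ≤ β) (hr : 0 < r)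
    (hball : ∀ i, ∃ x, Metric.ball x r ⊆ T.elem i) (hτ : 0 < τ) (hc : 0 < c)
    (hcube : ∀ a : (Fin d → Bool) → ℝ,
      ∑ σ, a σ ^ 2 ≤ c * ∫ t in Set.Icc (0 : Fin d → ℝ) 1, qint a t ^ 2)
    (s : Set (Fin T.card)) : CutSystem T.VhSub (Fin T.card) where
  m := T.massForm
  a i := energyForm hA hr τ i (hball i)
  hm _ := massForm_psd
  ha i := energyForm_psd hA hr τ (hball i)
  S k := (Set.toFinite (T.layer s k)).toFinset
  mono := fun _ _ h => Set.Finite.toFinset_mono (layer_mono s h)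
  Z k := T.cutLin (T.layer s k)
  -- Comparison through vertex values gives the constant 2^d c; adding 1 makes it at most its own
  -- square root bound, 2^d c ≤ κ₀², and ensures 1 ≤ κ.
  κ₀ := 1 + 2 ^ d * c
  κ := (1 + 2 ^ d * c) * (1 + Real.sqrt β * (d / r) * τ / 2)
  one_le := by
    have h1 : (1 : ℝ) ≤ 1 + 2 ^ d * c := le_add_of_nonneg_right (by positivity)
    have h2 : (1 : ℝ) ≤ 1 + Real.sqrt β * (d / r) * τ / 2 :=
      le_add_of_nonneg_right (by positivity)
    nlinarith
  cut_inside := by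
    intro k i hi v w
    have hz : Set.EqOn (T.cutLin (T.layer s k) v : E d → ℝ) ((0 : T.VhSub) : E d → ℝ) (T.elem i) :=
      fun x hx => cut_eq_zero ((Set.Finite.mem_toFinset _).1 hi) hx
    constructor
    · rw [massForm_apply, l2_elem_congr _ hz, ← massForm_apply, map_zero]
    · rw [energyForm_apply, aForm_elem_congr _ hz, ← energyForm_apply hA hr τ (hball i), map_zero]
  cut_outside := by
    intro k i hi v w
    have hz : Set.EqOn (T.cutLin (T.layer s k) v : E d → ℝ) v (T.elem i) :=
      fun x hx => cut_eq_self v.2 (fun hc => hi ((Set.Finite.mem_toFinset _).2 hc)) hx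
    constructor
    · rw [massForm_apply, l2_elem_congr _ hz, massForm_apply]
    · rw [energyForm_apply, aForm_elem_congr _ hz, energyForm_apply]
  cut_m := by
    intro k i v
    have h1 := l2_elem_le (i := i) (T.cutLin (T.layer s k) v).2
    have h2 := sum_abs_mono (T := T) (i := i) (v := T.cutLin (T.layer s k) v) (w := v)
      fun σ => abs_cut_vertex_le σ
    have h3 := mul_le_mul_of_nonneg_left h2 (measureReal_nonneg (μ := volume) (s := T.elem i))
    have h4 := volume_mul_sq_sum_le hcube v.2 i
    have h5 : 0 ≤ l2 (T.elem i) v v := massForm_psd.nonneg v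
    rw [massForm_apply, massForm_apply]
    refine (h1.trans (h3.trans h4)).trans (mul_le_mul_of_nonneg_right ?_ h5)
    have : 0 < 2 ^ d * c := by positivity
    nlinarith
  cut_b := by
    intro k i v
    have h1 := l2_elem_le (i := i) (T.cutLin (T.layer s k) v).2
    have h1' := aForm_elem_le hA hr (hball i) (T.cutLin (T.layer s k) v).2
    have h2 := sum_abs_mono (T := T) (i := i) (v := T.cutLin (T.layer s k) v) (w := v)
      fun σ => abs_cut_vertex_le σ
    have h3 := mul_le_mul_of_nonneg_left h2 (measureReal_nonneg (μ := volume) (s := T.elem i))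
    have h4 := h3.trans (volume_mul_sq_sum_le hcube v.2 i)
    have h5 : 0 ≤ l2 (T.elem i) v v := massForm_psd.nonneg v
    rw [massForm_apply, massForm_apply, energyForm_apply]
    set X := Real.sqrt β * (d / r) * τ / 2 with hX
    have hX0 : 0 ≤ X := by positivity
    -- X² is the constant of the inverse estimate for the scaled energy; 1 + X² ≤ (1 + X)² then
    -- gives κ.
    have hX2 : τ ^ 2 / 4 * (β * (d / r) ^ 2) = X ^ 2 := by
      rw [hX]
      linear_combination (-(τ ^ 2 / 4 * (d / r) ^ 2)) * Real.sq_sqrt hβ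
    have h6 := mul_le_mul_of_nonneg_left h1' (by positivity : 0 ≤ τ ^ 2 / 4)
    rw [← mul_assoc, hX2] at h6
    have h7 := mul_le_mul_of_nonneg_left h4 (by positivity : 0 ≤ 1 + X ^ 2)
    refine le_trans (by linarith : _ ≤ (1 + X ^ 2) * (2 ^ d * c * l2 (T.elem i) v v)) ?_
    rw [← mul_assoc]
    refine mul_le_mul_of_nonneg_right ?_ h5
    have h8 : 0 < 2 ^ d * c := by positivity
    rw [mul_pow, mul_comm]
    refine mul_le_mul (by nlinarith) (by nlinarith) (by positivity) (by positivity)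

section Global

variable (hA : T.IsCoeff A α β) (hβ : 0 ≤ β) (hr : 0 < r)
    (hball : ∀ i, ∃ x, Metric.ball x r ⊆ T.elem i) (hτ : 0 < τ) (hc : 0 < c)
    (hcube : ∀ a : (Fin d → Bool) → ℝ,
      ∑ σ, a σ ^ 2 ≤ c * ∫ t in Set.Icc (0 : Fin d → ℝ) 1, qint a t ^ 2)
    (s : Set (Fin T.card))

lemma cutSystem_mOn_univ (v w : T.VhSub) :
    (cutSystem hA hβ hr hball hτ hc hcube s).mOn Finset.univ v w = l2 T.domain v w := by
  rw [CutSystem.mOn_apply, l2, integral_domain fun i => integrableOn_mul v.2.1 w.2.1 i]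
  rfl

lemma cutSystem_aOn_univ (v w : T.VhSub) :
    (cutSystem hA hβ hr hball hτ hc hcube s).aOn Finset.univ v w =
      τ ^ 2 / 4 * aForm A T.domain v w := by
  rw [aForm, integral_domain fun i => integrableOn_energy hA hr (hball i) v.2 w.2, Finset.mul_sum]
  simp only [CutSystem.aOn, LinearMap.sum_apply]
  rfl

lemma cutSystem_semi_univ (v : T.VhSub) :
    semi ((cutSystem hA hβ hr hball hτ hc hcube s).bOn Finset.univ) v =
      cnNorm A τ T.domain v := by
  rw [semi, CutSystem.bOn_eq, LinearMap.add_apply, LinearMap.add_apply, cutSystem_mOn_univ,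
    cutSystem_aOn_univ, cnNorm]

lemma cutSystem_semi_eq_zero (v : T.VhSub) (h : Function.support (v : E d → ℝ) ⊆ T.unionOf s) :
    semi ((cutSystem hA hβ hr hball hτ hc hcube s).bOn
      ((cutSystem hA hβ hr hball hτ hc hcube s).S 0)ᶜ) v = 0 := by
  rw [semi, CutSystem.bOn_apply, Finset.sum_eq_zero, Real.sqrt_zero]
  intro i hi
  have hi' : i ∉ s := fun hc' => by
    rw [Finset.mem_compl] at hi
    exact hi ((Set.Finite.mem_toFinset _).2 hc')
  have hz : Set.EqOn (v : E d → ℝ) ((0 : T.VhSub) : E d → ℝ) (T.elem i) :=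
    fun x hx => eq_zero_of_support_subset v.2.1 h hi' hx
  change T.massForm i v v + energyForm hA hr τ i (hball i) v v = 0
  rw [massForm_apply, energyForm_apply, l2_elem_congr _ hz, aForm_elem_congr _ hz,
    ← massForm_apply, ← energyForm_apply hA hr τ (hball i), map_zero, map_zero, add_zero]

end Global

lemma interior_unionOf_subset_domain (s : Set (Fin T.card)) :
    interior (T.unionOf s) ⊆ T.domain :=
  interior_mono (Set.biUnion_subset_biUnion_left (Set.subset_univ s))

/-- With the analogue for the energy, this turns the local scheme into the global one tested with
fewer functions, so the two can be subtracted. -/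
lemma l2_eq_domain {s : Set (Fin T.card)} {v : E d → ℝ}
    (hv : Function.support v ⊆ interior (T.unionOf s)) (w : E d → ℝ) :
    l2 (interior (T.unionOf s)) w v = l2 T.domain w v := by
  refine (setIntegral_eq_of_subset_of_forall_sdiff_eq_zero isOpen_interior.measurableSet
    (interior_unionOf_subset_domain s) fun x hx => ?_).symm
  have : v x = 0 := by by_contra h; exact hx.2 (hv h)
  rw [this, mul_zero]

/-- Off the closed union v vanishes in a neighbourhood and so does its gradient; what remains is a
null set. -/
lemma aForm_eq_domain {s : Set (Fin T.card)} {v : E d → ℝ}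
    (hv : Function.support v ⊆ interior (T.unionOf s)) (w : E d → ℝ) :
    aForm A (interior (T.unionOf s)) w v = aForm A T.domain w v := by
  refine (setIntegral_eq_of_subset_of_ae_sdiff_eq_zero
    isOpen_interior.measurableSet.nullMeasurableSet (interior_unionOf_subset_domain s) ?_).symm
  filter_upwards [interior_unionOf_ae s] with x hx hxd
  have hx' : x ∉ T.unionOf s := fun h => hxd.2 (hx.mpr h)
  have hz : v =ᶠ[nhds x] fun _ => 0 := by
    filter_upwards [(isClosed_unionOf s).isOpen_compl.mem_nhds hx'] with y hy
    by_contra h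
    exact hy (interior_subset (hv h))
  rw [gradient_congr hz, gradient_fun_const, inner_zero_right, mul_zero]

lemma l2_eq_zero_of_union {s : Set (Fin T.card)} {f v : E d → ℝ}
    (hf : ∀ᵐ x ∂(volume.restrict T.domain), x ∉ T.unionOf s → f x = 0)
    (hv : ∀ i ∈ s, ∀ x ∈ T.elem i, v x = 0) : l2 T.domain f v = 0 := by
  refine integral_eq_zero_of_ae ?_
  filter_upwards [hf] with x hx
  by_cases h : x ∈ T.unionOf s
  · obtain ⟨i, hi, hxi⟩ := mem_unionOf.1 h
    simp [hv i hi x hxi]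
  · simp [hx h]

/-- The integrated data vanish on test functions that vanish where the source lives. -/
lemma l2_hatAvg_eq_zero {z : ℕ → E d → ℝ} {n : ℕ} {v : E d → ℝ} (hv : v ∈ T.Vh)
    (hz : ∀ k, z k ∈ T.Vh) (h : ∀ k, l2 T.domain (z k) v = 0) :
    l2 T.domain (hatAvg z n) v = 0 := by
  have hint : ∀ k, IntegrableOn (fun x => z k x * v x) T.domain := fun k =>
    (((hz k).1.mul hv.1).continuousOn.integrableOn_compact
      (isCompact_iUnion fun i : Fin T.card => isCompact_elem (i := i))).mono_set
      fun x hx => Set.mem_iUnion.2 (mem_elem_of_mem_domain hx)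
  have e : ∀ x, hatAvg z n x * v x =
      1 / 4 * (z (n + 1) x * v x) + 1 / 2 * (z n x * v x) + 1 / 4 * (z (n - 1) x * v x) := by
    intro x; simp only [hatAvg]; ring
  unfold l2 at h ⊢
  simp only [e]
  have hi : IntegrableOn (fun x => 1 / 4 * (z (n + 1) x * v x) + 1 / 2 * (z n x * v x)) T.domain :=
    ((hint _).const_mul _).add ((hint _).const_mul _)
  rw [integral_add hi ((hint _).const_mul _),
    integral_add ((hint _).const_mul _) ((hint _).const_mul _), integral_const_mul,
    integral_const_mul, integral_const_mul, h, h, h]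
  simp

end Mesh

/-! ### Difference quotients and means in the abstract notation. -/

lemma secondDiff_eq {d : ℕ} {T : Mesh d} (τ : ℝ) (z : ℕ → T.VhSub) (n : ℕ) :
    secondDiff τ (fun k => (z k : E d → ℝ)) (n + 1) =
      (((τ ^ 2)⁻¹ • del z n : T.VhSub) : E d → ℝ) := by
  funext x
  simp only [secondDiff, del, Nat.add_sub_cancel, Submodule.coe_smul, Submodule.coe_add,
    Submodule.coe_sub, Pi.smul_apply, Pi.add_apply, Pi.sub_apply, smul_eq_mul]
  ring

lemma hatAvg_eq {d : ℕ} {T : Mesh d} (z : ℕ → T.VhSub) (n : ℕ) :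
    hatAvg (fun k => (z k : E d → ℝ)) (n + 1) =
      (((1 / 4 : ℝ) • sig z n : T.VhSub) : E d → ℝ) := by
  funext x
  simp only [hatAvg, sig, Nat.add_sub_cancel, Submodule.coe_smul, Submodule.coe_add,
    Pi.smul_apply, Pi.add_apply, smul_eq_mul]
  ring

lemma halfStep_eq {d : ℕ} {T : Mesh d} (z : ℕ → T.VhSub) (n : ℕ) :
    halfStep (fun k => (z k : E d → ℝ)) n = ((half z n : T.VhSub) : E d → ℝ) := by
  funext x
  simp only [halfStep, half, Submodule.coe_smul, Submodule.coe_add, Pi.smul_apply, Pi.add_apply,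
    smul_eq_mul]
  ring

end WaveLoc

end

/-! ### The theorem: choice of constants and passage to the abstract estimate. -/

open WaveLoc in
theorem theorem3p2 (d : ℕ) (hd : 1 ≤ d) (α β ρ : ℝ) (hα : 0 < α) (hαβ : α ≤ β) (hρ : 0 < ρ) :
    -- `c` is the constant in `C_{τ,h} = c (β/α) (τ/h + h/τ)`, and `C` is the one hidden in `≲`
    ∃ c C : ℝ, 0 < c ∧ 0 < C ∧
      ∀ (T : Mesh d) (h τ : ℝ), 0 < h → 0 < τ → T.IsQuasiUniform ρ h →
      -- the coefficient
      ∀ A : E d → ℝ, AEMeasurable A (volume.restrict T.domain) →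
        (∀ᵐ x ∂(volume.restrict T.domain), α ≤ A x ∧ A x ≤ β) →
      -- the union `ω` of elements that carries the data
      ∀ (s : Set (Fin T.card)) (ω : Set (E d)), ω = T.unionOf s →
      -- the source, and its approximations in `V_h`: `L²`-projections, or supported in `ω`
      ∀ f : ℝ → E d → ℝ, (∀ t, 0 ≤ t → MemLp (f t) 2 (volume.restrict T.domain)) →
        (∀ t, 0 ≤ t → ∀ᵐ x ∂(volume.restrict T.domain), x ∉ ω → f t x = 0) →
      ∀ fh : ℕ → E d → ℝ, (∀ k, fh k ∈ T.Vh) →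
        (∀ k : ℕ, (∀ v ∈ T.Vh, l2 T.domain (fh k) v = l2 T.domain (f (k * τ)) v) ∨
          Function.support (fh k) ⊆ ω) →
      -- the global solution with local initial data
      ∀ u : ℕ → E d → ℝ, IsCrankNicolson A τ T.domain T.Vh fh u →
        u 0 ∈ T.VhOn ω → u 1 ∈ T.VhOn ω →
      -- the localized solution
      ∀ l : ℕ, 1 ≤ l →
      ∀ u' : ℕ → E d → ℝ,
        IsCrankNicolson A τ (T.patch ω l) (T.VhOn (T.patch ω l)) fh u' →
        u' 0 = u 0 → u' 1 = u 1 →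
      ∀ n : ℕ,
        cnNorm A τ T.domain (fun x => halfStep u n x - halfStep u' n x) ≤
          C * (c * (β / α) * (τ / h + h / τ)) * (9 * (l : ℝ)) ^ ((n : ℝ) / 2) *
            decayRate (c * (β / α) * (τ / h + h / τ)) ^ l *
            (Finset.range (n + 1)).sup' Finset.nonempty_range_add_one
              (fun k => cnNorm A τ T.domain (halfStep u k)) := by
  obtain ⟨c₀, hc₀, hcube⟩ := exists_sum_sq_le_integral d
  have hβ : 0 ≤ β := hα.le.trans hαβ
  set κ₀ := 1 + 2 ^ d * c₀ with hκ₀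
  have hκ₀pos : 0 < κ₀ := by positivity
  -- Chosen so that c X ≥ 256 and c X ≥ 2κ + κ₀² for X = τ/h + h/τ, where 2κ + κ₀² = 2κ₀ + κ₀² + κ₀
  -- √β d ρ (τ/h). The factor β/α ≥ 1 only enlarges K.
  set c := 256 + 2 * κ₀ + κ₀ ^ 2 + κ₀ * Real.sqrt β * d * ρ with hcdef
  have hcpos : 0 < c := by positivity
  refine ⟨c, 16384, hcpos, by norm_num, ?_⟩
  intro T h τ hh hτ hT A hAm hAb s ω hω f _ hf fh hfh hfhω u hu hu0 hu1 l hl u' hu' e0 e1 n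
  subst hω
  -- Cutting at layer l leaves a remainder supported in layer l + 1, which is the local patch.
  obtain ⟨l, rfl⟩ : ∃ m, l = m + 1 := ⟨l - 1, by omega⟩
  have hA : T.IsCoeff A α β := ⟨hα, hAm, hAb⟩
  have hr : 0 < h / ρ := div_pos hh hρ
  have hball : ∀ i, ∃ x, Metric.ball x (h / ρ) ⊆ T.elem i := fun i => (hT i).2
  set D := Mesh.cutSystem hA hβ hr hball hτ hc₀ hcube s with hD
  set X := τ / h + h / τ with hX
  have hq : 0 < τ / h := div_pos hτ hh
  have hX2 : 2 ≤ X := by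
    have e : h / τ = (τ / h)⁻¹ := (inv_div τ h).symm
    have hm : τ / h * (τ / h)⁻¹ = 1 := mul_inv_cancel₀ hq.ne'
    have hp : 0 < (τ / h)⁻¹ := inv_pos.2 hq
    rw [hX, e]
    nlinarith [sq_nonneg (τ / h - (τ / h)⁻¹)]
  have hXτ : τ / h ≤ X := le_add_of_nonneg_right (div_pos hh hτ).le
  have hβα : 1 ≤ β / α := (one_le_div hα).2 hαβ
  set K := c * (β / α) * X with hK
  have hcK : c * X ≤ K := by
    rw [hK]
    nlinarith [mul_nonneg hcpos.le (by linarith : 0 ≤ X)]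
  have hs0 : 0 ≤ κ₀ * Real.sqrt β * d * ρ := by positivity
  have hK256 : 256 ≤ K := by nlinarith [sq_nonneg κ₀]
  have hKκ : 2 * D.κ + D.κ₀ ^ 2 ≤ K := by
    have hDκ : D.κ = κ₀ * (1 + Real.sqrt β * (d / (h / ρ)) * τ / 2) := rfl
    have hDκ₀ : D.κ₀ = κ₀ := rfl
    have e : 2 * D.κ + D.κ₀ ^ 2 =
        2 * κ₀ + κ₀ ^ 2 + (κ₀ * Real.sqrt β * d * ρ) * (τ / h) := by
      rw [hDκ, hDκ₀]; field_simp; ring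
    rw [e]
    have := mul_le_mul_of_nonneg_left hXτ hs0
    refine le_trans ?_ hcK
    rw [hcdef]
    nlinarith [mul_nonneg hκ₀pos.le (by linarith : 0 ≤ X - 1),
      mul_nonneg (sq_nonneg κ₀) (by linarith : 0 ≤ X - 1)]
  have hγ0 : 0 ≤ decayRate K := Real.sqrt_nonneg _
  have hγ : (1 + K) * decayRate K ^ 2 = K + 1 / 2 := by
    rw [decayRate, Real.sq_sqrt (by positivity)]
    field_simp
  set M := (Finset.range (n + 1)).sup' Finset.nonempty_range_add_one
    (fun k => cnNorm A τ T.domain (halfStep u k)) with hM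
  -- the solutions as sequences in the finite element space
  set z : ℕ → T.VhSub := fun k => ⟨u k, hu.1 k⟩ with hz
  set z' : ℕ → T.VhSub := fun k => ⟨u' k, (hu'.1 k).1⟩ with hz'
  have hpatch := Mesh.patch_eq s l
  have hτ2 : τ ^ 2 ≠ 0 := by positivity
  -- The scheme multiplied by τ²: the 1/4 of the weighted mean goes into the scaled energy τ²/4 a.
  -- The abstract index n is centred at the time step n + 1.
  have hglob : ∀ n (v : T.VhSub), D.mOn Finset.univ (del z n) v + D.aOn Finset.univ (sig z n) v =
      τ ^ 2 * l2 T.domain (hatAvg fh (n + 1)) v := by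
    intro n v
    have e := hu.2 (n + 1) (by omega) v v.2
    have e2 := secondDiff_eq τ z n
    have e3 := hatAvg_eq z n
    change secondDiff τ u (n + 1) = _ at e2
    change hatAvg u (n + 1) = _ at e3
    rw [e2, e3, ← Mesh.cutSystem_mOn_univ hA hβ hr hball hτ hc₀ hcube s] at e
    rw [← e, mul_add]
    congr 1
    · rw [map_smul, LinearMap.smul_apply, smul_eq_mul, mul_inv_cancel_left₀ hτ2]
    · have e4 := Mesh.cutSystem_aOn_univ hA hβ hr hball hτ hc₀ hcube s ((1 / 4 : ℝ) • sig z n) v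
      rw [map_smul, LinearMap.smul_apply, smul_eq_mul] at e4
      linarith
  let W : Submodule ℝ T.VhSub :=
    { carrier := {v | Function.support (v : E d → ℝ) ⊆ interior (T.unionOf (T.layer s (l + 1)))}
      add_mem' := fun hv hw =>
        (Function.support_add _ _).trans (Set.union_subset hv hw)
      zero_mem' := by simp
      smul_mem' := fun c v hv => (Function.support_const_smul_subset c _).trans hv }
  have hloc : ∀ n, ∀ v ∈ W, D.mOn Finset.univ (del z' n) v + D.aOn Finset.univ (sig z' n) v =
      τ ^ 2 * l2 T.domain (hatAvg fh (n + 1)) v := by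
    intro n v hv
    have e := hu'.2 (n + 1) (by omega) v ⟨v.2, by rw [hpatch]; exact hv⟩
    have e2 := secondDiff_eq τ z' n
    have e3 := hatAvg_eq z' n
    change secondDiff τ u' (n + 1) = _ at e2
    change hatAvg u' (n + 1) = _ at e3
    rw [hpatch, Mesh.l2_eq_domain hv, Mesh.l2_eq_domain hv, Mesh.aForm_eq_domain hv, e2, e3,
      ← Mesh.cutSystem_mOn_univ hA hβ hr hball hτ hc₀ hcube s] at e
    rw [← e, mul_add]
    congr 1
    · rw [map_smul, LinearMap.smul_apply, smul_eq_mul, mul_inv_cancel_left₀ hτ2]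
    · have e4 := Mesh.cutSystem_aOn_univ hA hβ hr hball hτ hc₀ hcube s ((1 / 4 : ℝ) • sig z' n) v
      rw [map_smul, LinearMap.smul_apply, smul_eq_mul] at e4
      linarith
  -- The L²-projection of f need not be supported in ω, but paired with a function of V_h it can be
  -- replaced by f, and the cut-off functions vanish on ω.
  have hF : ∀ n k (v : T.VhSub), l2 T.domain (hatAvg fh n) (D.Z k v) = 0 := by
    intro n k v
    refine Mesh.l2_hatAvg_eq_zero (D.Z k v).2 hfh fun j => ?_
    have hv : ∀ i ∈ s, ∀ x ∈ T.elem i, (D.Z k v : E d → ℝ) x = 0 := fun i hi x hx =>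
      Mesh.cut_eq_zero (Mesh.layer_mono s (Nat.zero_le k) hi) hx
    rcases hfhω j with hp | hp
    · rw [hp _ (D.Z k v).2]
      exact Mesh.l2_eq_zero_of_union (hf _ (by positivity)) hv
    · refine Mesh.l2_eq_zero_of_union (Filter.Eventually.of_forall fun x hx => ?_) hv
      by_contra hne
      exact hx (hp hne)
  -- The second difference is four times the weighted mean minus four times the middle value, so the
  -- time step becomes an elliptic problem with the middle value as right-hand side.
  have heq : ∀ n k v, D.bOn Finset.univ ((1 / 4 : ℝ) • sig z n) (D.Z k v) =
      D.mOn Finset.univ (z (n + 1)) (D.Z k v) := by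
    intro n k v
    have e := hglob n (D.Z k v)
    rw [hF, mul_zero, del_eq] at e
    rw [CutSystem.bOn_eq]
    simp only [map_smul, map_sub, LinearMap.add_apply, LinearMap.sub_apply, LinearMap.smul_apply,
      smul_eq_mul] at e ⊢
    linarith
  have hMb : ∀ j ≤ n, semi (D.bOn Finset.univ) (half z j) ≤ M := by
    intro j hj
    rw [hD, Mesh.cutSystem_semi_univ, ← halfStep_eq]
    exact Finset.le_sup' (fun k => cnNorm A τ T.domain (halfStep u k))
      (Finset.mem_range.2 (by omega))
  have main := D.localization_error z z' W K (decayRate K) M l n hKκ hK256 hγ0 hγ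
    (Mesh.cutSystem_semi_eq_zero hA hβ hr hball hτ hc₀ hcube s _ hu0.2)
    (Mesh.cutSystem_semi_eq_zero hA hβ hr hball hτ hc₀ hcube s _ hu1.2)
    heq hMb (fun k => by have := (hu'.1 k).2; rwa [hpatch] at this)
    (fun v => by
      refine Mesh.support_subset_interior (v - D.Z l v).2 fun i hi x hx => ?_
      have : T.cut (T.layer s l) v x = (v : E d → ℝ) x := Mesh.cut_eq_self v.2 hi hx
      change (v : E d → ℝ) x - T.cut (T.layer s l) v x = 0
      rw [this, sub_self])
    (fun n v hv => by
      have a1 := hglob n v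
      have a2 := hloc n v hv
      have b1 : del (fun n => z n - z' n) n = del z n - del z' n := by unfold del; module
      have b2 : sig (fun n => z n - z' n) n = sig z n - sig z' n := by unfold sig; module
      rw [b1, b2, map_sub, map_sub, LinearMap.sub_apply, LinearMap.sub_apply]
      linarith)
    (Subtype.ext e0) (Subtype.ext e1)
  have hlhs : (fun x => halfStep u n x - halfStep u' n x) =
      (half (fun n => z n - z' n) n : T.VhSub) := by
    have b : half (fun n => z n - z' n) n = half z n - half z' n := by unfold half; module
    rw [b, Submodule.coe_sub, ← halfStep_eq, ← halfStep_eq]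
    rfl
  have hpow : (9 * ((l + 1 : ℕ) : ℝ)) ^ ((n : ℝ) / 2) = (3 * Real.sqrt (l + 1 : ℕ)) ^ n := by
    have h9 : (3 * Real.sqrt (l + 1 : ℕ)) = Real.sqrt (9 * ((l + 1 : ℕ) : ℝ)) := by
      rw [Real.sqrt_mul (by norm_num), show (9 : ℝ) = 3 ^ 2 by norm_num,
        Real.sqrt_sq (by norm_num)]
    rw [h9, Real.sqrt_eq_rpow, ← Real.rpow_natCast, ← Real.rpow_mul (by positivity)]
    congr 1; ring
  rw [hlhs, hpow, ← Mesh.cutSystem_semi_univ hA hβ hr hball hτ hc₀ hcube s]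
  exact main
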